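/- Consider the equations $\mathcal P_f$: $v_t+v_x^2+f(t,x)v_{xx}=0$, where $f$ is a smooth nowhere vanishing function on a domain $D\subset\mathbb R^2$ (an open connected set whose sections $t=\mathrm{const}$ are intervals). Let $\mathcal P^2$ be the subclass of the equations $\mathcal P_f$ with $f_{xxx}=0$ and $f\neq\mathrm{const}$; since all considerations are local, the latter means that $f$ is constant on no nonempty open subset of $D$. For such an equation, $f=f^2(t)x^2+f^1(t)x+f^0(t)$, where $f^2=\tfrac12f_{xx}$, $f^1=f_x-xf_{xx}$ and $f^0=f+\tfrac12x^2f_{xx}-xf_x$ depend only on $t$. An admissible transformation in $\mathcal P^2$ is a triple $(f,\varphi,\tilde f)$ in which $\mathcal P_f,\mathcal P_{\tilde f}\in\mathcal P^2$ and $\varphi\colon(t,x,v)\mapsto(\tilde t,\tilde x,\tilde v)$ is a point transformation, i.e. a smooth diffeomorphism of a connected open set of the space of $(t,x,v)$, lying over the domain of $f$, onto an open set, lying over the domain of $\tilde f$, that maps $\mathcal P_f$ to $\mathcal P_{\tilde f}$. The generalized extended equivalence group of $\mathcal P^2$ consists of the families that assign to every equation $\mathcal P_f\in\mathcal P^2$,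 with an arbitrary (possibly nonlocal) dependence on $f$, a point transformation $\varphi_f$ and an equation $\mathcal P_{\tilde f}\in\mathcal P^2$ such that $(f,\varphi_f,\tilde f)$ is admissible. An integral with respect to $t$ means a fixed antiderivative; the theorem holds for every way of fixing them. For constants $c_0,\ldots,c_6$ with $c_0\ne0$ and $(c_1,c_2)\ne(0,0)$ consider the transformations \begin{gather*} \tilde t=\frac1{c_0}\int (X^1)^2\,dt+c_5,\qquad \tilde x=X^1x+\int (X^1)^2\left(c_1\int\frac{f^1}{\lambda}\,dt+c_3\right)dt+c_4,\\ \tilde v=c_0\left(v-\frac{c_1X^1}{4\lambda}x^2+X^2x+\int (X^2)^2\,dt+\frac{c_1}2\int\frac{f^0}{\lambda}X^1\,dt\right)+c_6,\qquad \tilde f=c_0f, \end{gather*} where \[ \lambda=e^{2\int f^2dt},\qquad X^1=\left(c_1\int\frac{dt}{\lambda}+c_2\right)^{-1},\qquad X^2=\frac{X^1}{2}\left(c_1\int\frac{f^1}{\lambda}\,dt+c_3\right), \] over intervals of values of $t$ on which $c_1\int dt/\lambda+c_2$ has no zeros. Then: (a) The generalized extended equivalence group of $\mathcal P^2$ is constituted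 by these transformations: a family of point transformations belongs to it if and only if it acts on each equation of $\mathcal P^2$ by the above formulas with some constants $c_0,\ldots,c_6$ (which, for an element of this group, may differ from equation to equation). Conversely, for every value of the tuple of constants the formulas are defined over some interval of values of $t$ for each equation of $\mathcal P^2$ and, over any choice of such intervals, give an element of the group, mapping each $\mathcal P_f$ (restricted to the interval) onto an equation $\mathcal P_{\tilde f}\in\mathcal P^2$. (b) The local transformations given by these formulas are closed under composition and inversion. (c) The subclass $\mathcal P^2$ is normalized in the generalized extended sense: every admissible transformation in $\mathcal P^2$ is induced by an element of its generalized extended equivalence group, and this element can be chosen to have the above form with the same constants for all equations of $\mathcal P^2$. -/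

import Mathlib

open Set Filter Topology
open scoped ContDiff

/-- A generalized potential Burgers equation `v_t + v_x ^ 2 + f(t,x) v_xx = 0` with smooth, nowhere
vanishing coefficient `f`, considered on a domain of the `(t,x)`-plane (an open connected set all of
whose sections `t = const` are intervals). Only the values of `f` on `dom` matter. -/
structure PotBurgers where
  dom : Set (ℝ × ℝ)
  f : ℝ × ℝ → ℝ
  isOpen_dom : IsOpen dom
  isConnected_dom : IsConnected dom
  ordConnected_slice : ∀ t : ℝ, {x : ℝ | (t, x) ∈ dom}.OrdConnected
  contDiffOn_f : ContDiffOn ℝ ∞ f dom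
  f_ne_zero : ∀ p ∈ dom, f p ≠ 0

/-- The function `v` satisfies `v_t + v_x ^ 2 + f v_xx = 0` at the point `p = (t,x)`. Only the
second-order jet of `v` at `p` enters. -/
def SatisfiesAt (f v : ℝ × ℝ → ℝ) (p : ℝ × ℝ) : Prop :=
  deriv (fun s => v (s, p.2)) p.1 + (deriv (fun y => v (p.1, y)) p.2) ^ 2
    + f p * iteratedDeriv 2 (fun y => v (p.1, y)) p.2 = 0

/-- The point `(t,x)` below the point `(t,x,v)`. -/
def base (q : ℝ × ℝ × ℝ) : ℝ × ℝ := (q.1, q.2.1)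

/-- The point `(t,x,v)` lies on the graph of the function `v`. -/
def OnGraph (v : ℝ × ℝ → ℝ) (q : ℝ × ℝ × ℝ) : Prop := q.2.2 = v (base q)

/-- Local homeomorphisms of the space of `(t,x,v)`; no component of the map is supposed to be
independent of any of the three variables. -/
abbrev LocalMap : Type := OpenPartialHomeomorph (ℝ × ℝ × ℝ) (ℝ × ℝ × ℝ)

/-- `φ` is a point transformation (a smooth diffeomorphism of a connected open set of the space of
`(t,x,v)` onto an open set), its source lies over the domain of `E` and its target over that
of `E'`. -/
structure IsPointTransformation (E : PotBurgers) (φ : LocalMap) (E' : PotBurgers) : Prop where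
  contDiffOn : ContDiffOn ℝ ∞ φ φ.source
  contDiffOn_symm : ContDiffOn ℝ ∞ φ.symm φ.target
  isConnected_source : IsConnected φ.source
  source_subset : ∀ q ∈ φ.source, base q ∈ E.dom
  target_subset : ∀ q ∈ φ.target, base q ∈ E'.dom

/-- `φ` maps the equation `E` to the equation `E'`, as submanifolds of the second-order jet space:
whenever `φ` maps the graph of a smooth function `v` locally, near a point `q` of it, onto the graph
of a smooth function `v'`, the jet of `v` at the point below `q` satisfies `E` if and only if the
jet of `v'` at the point below `φ q` satisfies `E'`. -/
def MapsEquation (E : PotBurgers) (φ : LocalMap) (E' : PotBurgers) : Prop :=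
  ∀ q ∈ φ.source, ∀ v v' : ℝ × ℝ → ℝ,
    ContDiffAt ℝ ∞ v (base q) → ContDiffAt ℝ ∞ v' (base (φ q)) →
    OnGraph v q → OnGraph v' (φ q) →
    (∀ᶠ r in 𝓝 q, OnGraph v r ↔ OnGraph v' (φ r)) →
    (SatisfiesAt E.f v (base q) ↔ SatisfiesAt E'.f v' (base (φ q)))

/-- `(E, φ, E')` is an admissible transformation: a point transformation of `E` to `E'`. -/
def IsAdmissible (E : PotBurgers) (φ : LocalMap) (E' : PotBurgers) : Prop :=
  IsPointTransformation E φ E' ∧ MapsEquation E φ E'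

/-- A family of local maps of the space of `(t,x,v)` depending in an arbitrary (in particular,
nonlocal) way on an equation of the class `K`, together with an action on the equations of `K`. -/
structure Family (K : Set PotBurgers) where
  map : K → LocalMap
  tgt : K → K

/-- The generalized extended equivalence group of a class `K`, whose elements are equation-dependent
point transformations that map every equation of `K` to an equation of `K`. -/
def genExtEquivGroup (K : Set PotBurgers) : Set (Family K) :=
  {Φ | ∀ E : K, IsAdmissible E (Φ.map E) (Φ.tgt E)}

/-- The class `K` is normalized with respect to the set `S` of families: every admissible
transformation in `K` is induced by an element of `S`. -/
def IsNormalizedBy (K : Set PotBurgers) (S : Set (Family K)) : Prop :=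
  ∀ (E : K) (φ : LocalMap) (E' : K), IsAdmissible E φ E' →
    ∃ Φ ∈ S, Φ.map E = φ ∧ Φ.tgt E = E'

/-- The (local) transformations induced by the elements of `S` are closed under inversion and under
composition, where a composition may be restricted to any connected open part of its domain. -/
def IsLocalGroup {K : Set PotBurgers} (S : Set (Family K)) : Prop :=
  (∀ Φ ∈ S, ∀ E : K, ∃ Ψ ∈ S, Ψ.map (Φ.tgt E) = (Φ.map E).symm ∧ Ψ.tgt (Φ.tgt E) = E) ∧
  (∀ Φ ∈ S, ∀ Ψ ∈ S, ∀ (E : K) (W : Set (ℝ × ℝ × ℝ)), IsOpen W →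
    IsConnected (((Φ.map E).trans (Ψ.map (Φ.tgt E))).restr W).source →
    ∃ Ω ∈ S, Ω.map E = ((Φ.map E).trans (Ψ.map (Φ.tgt E))).restr W ∧
      Ω.tgt E = Ψ.tgt (Φ.tgt E))

/-- The subclass singled out by `f_xxx = 0` and `f ≠ const`. As everything here is local, `f ≠ const`
means that `f` is constant on no nonempty open subset of its domain (for analytic `f` this is the
same as being nonconstant). -/
def quadClass : Set PotBurgers :=
  {E | (∀ p ∈ E.dom, iteratedDeriv 3 (fun y => E.f (p.1, y)) p.2 = 0) ∧
    ∀ W : Set (ℝ × ℝ), IsOpen W → W.Nonempty → W ⊆ E.dom → ¬ ∃ k : ℝ, ∀ p ∈ W, E.f p = k}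

namespace PotBurgers

/-- The interval of values of `t`. -/
def times (E : PotBurgers) : Set ℝ := Prod.fst '' E.dom

/-- Some `x` with `(t,x)` in the domain. -/
noncomputable def somePt (E : PotBurgers) (t : ℝ) : ℝ := Classical.epsilon fun x => (t, x) ∈ E.dom

/-- `f_x` at `(t, somePt t)`. -/
noncomputable def fx (E : PotBurgers) (t : ℝ) : ℝ := deriv (fun y => E.f (t, y)) (E.somePt t)

/-- `f_xx` at `(t, somePt t)`. -/
noncomputable def fxx (E : PotBurgers) (t : ℝ) : ℝ :=
  iteratedDeriv 2 (fun y => E.f (t, y)) (E.somePt t)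

/-- The coefficient `f² = f_xx / 2` of `x ^ 2` in `f`; for `f_xxx = 0` the choice of the point `x`
is immaterial in this and the next two definitions. -/
noncomputable def f2 (E : PotBurgers) (t : ℝ) : ℝ := E.fxx t / 2

/-- The coefficient `f¹ = f_x - x f_xx` of `x` in `f`. -/
noncomputable def f1 (E : PotBurgers) (t : ℝ) : ℝ := E.fx t - E.somePt t * E.fxx t

/-- The coefficient `f⁰ = f + x ^ 2 f_xx / 2 - x f_x`. -/
noncomputable def f0 (E : PotBurgers) (t : ℝ) : ℝ :=
  E.f (t, E.somePt t) + E.somePt t ^ 2 / 2 * E.fxx t - E.somePt t * E.fx t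

end PotBurgers

/-- A way of fixing an antiderivative `int J g` of every continuous function `g` on every open
interval `J`. -/
structure AntiderivativeChoice where
  int : Set ℝ → (ℝ → ℝ) → ℝ → ℝ
  hasDerivAt_int : ∀ (J : Set ℝ) (g : ℝ → ℝ), IsOpen J → J.OrdConnected → ContinuousOn g J →
    ∀ t ∈ J, HasDerivAt (int J g) (g t) t

/-- The tuples of constants. -/
structure Constants where
  (c0 c1 c2 c3 c4 c5 c6 : ℝ)
  c0_ne_zero : c0 ≠ 0
  c1_c2_ne_zero : (c1, c2) ≠ (0, 0)

section Formulas

namespace AntiderivativeChoice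

/-- `λ = exp (2 ∫ f² dt)`. -/
noncomputable def lam (P : AntiderivativeChoice) (E : PotBurgers) (t : ℝ) : ℝ :=
  Real.exp (2 * P.int E.times E.f2 t)

/-- The denominator `c₁ ∫ dt / λ + c₂` of `X¹`. -/
noncomputable def den (P : AntiderivativeChoice) (c : Constants) (E : PotBurgers) (t : ℝ) : ℝ :=
  c.c1 * P.int E.times (fun s => 1 / P.lam E s) t + c.c2

/-- `X¹`. -/
noncomputable def X1 (P : AntiderivativeChoice) (c : Constants) (E : PotBurgers) (t : ℝ) : ℝ :=
  (P.den c E t)⁻¹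

/-- `c₁ ∫ (f¹ / λ) dt + c₃`. -/
noncomputable def Y (P : AntiderivativeChoice) (c : Constants) (E : PotBurgers) (t : ℝ) : ℝ :=
  c.c1 * P.int E.times (fun s => E.f1 s / P.lam E s) t + c.c3

/-- `X² = (X¹ / 2) (c₁ ∫ (f¹ / λ) dt + c₃)`. -/
noncomputable def X2 (P : AntiderivativeChoice) (c : Constants) (E : PotBurgers) (t : ℝ) : ℝ :=
  P.X1 c E t / 2 * P.Y c E t

/-- The `t`-component, where `J` is an interval on which the denominator of `X¹` has no zeros. -/
noncomputable def tNew (P : AntiderivativeChoice) (c : Constants) (E : PotBurgers) (J : Set ℝ)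
    (t : ℝ) : ℝ :=
  1 / c.c0 * P.int J (fun s => P.X1 c E s ^ 2) t + c.c5

/-- The `x`-component. -/
noncomputable def xNew (P : AntiderivativeChoice) (c : Constants) (E : PotBurgers) (J : Set ℝ)
    (t x : ℝ) : ℝ :=
  P.X1 c E t * x + P.int J (fun s => P.X1 c E s ^ 2 * P.Y c E s) t + c.c4

/-- The `v`-component. -/
noncomputable def vNew (P : AntiderivativeChoice) (c : Constants) (E : PotBurgers) (J : Set ℝ)
    (t x v : ℝ) : ℝ :=
  c.c0 * (v - c.c1 * P.X1 c E t / (4 * P.lam E t) * x ^ 2 + P.X2 c E t * x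
    + P.int J (fun s => P.X2 c E s ^ 2) t
    + c.c1 / 2 * P.int J (fun s => E.f0 s / P.lam E s * P.X1 c E s) t) + c.c6

end AntiderivativeChoice

end Formulas

/-- `φ` and the passage from `E` to `E'` are given, on the source of `φ`, by the formulas with the
constants `c`; in particular `f' = c₀ f`. -/
def HasForm (P : AntiderivativeChoice) (c : Constants) (E : PotBurgers) (φ : LocalMap)
    (E' : PotBurgers) : Prop :=
  (∀ q ∈ φ.source, P.den c E q.1 ≠ 0) ∧
  (∀ q ∈ φ.source, φ q =
    (P.tNew c E (Prod.fst '' φ.source) q.1,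
     P.xNew c E (Prod.fst '' φ.source) q.1 q.2.1,
     P.vNew c E (Prod.fst '' φ.source) q.1 q.2.1 q.2.2)) ∧
  (∀ q ∈ φ.source, E'.f (base (φ q)) = c.c0 * E.f (base q))

/-- The families of point transformations that are given on all the equations of the subclass by the
formulas with the same constants. -/
def formFamilies (P : AntiderivativeChoice) : Set (Family quadClass) :=
  {Φ | ∃ c : Constants, ∀ E : quadClass,
    IsPointTransformation E (Φ.map E) (Φ.tgt E) ∧ HasForm P c E (Φ.map E) (Φ.tgt E)}

/-- A choice, for every equation of the subclass, of a nonempty open interval of values of `t` on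
which the formulas with the constants `c` are defined. -/
def IsRegularChoice (P : AntiderivativeChoice) (c : Constants) (J : quadClass → Set ℝ) : Prop :=
  ∀ E : quadClass, IsOpen (J E) ∧ (J E).OrdConnected ∧ (J E).Nonempty ∧ J E ⊆ E.1.times ∧
    ∀ t ∈ J E, P.den c E t ≠ 0

/-!
Let `φ = (T, X, V)` be an admissible transformation. It is pushed through jets: an arbitrary 2-jet
of a solution of the target equation is realized by a quadratic polynomial, whose graph is pulled
back by the implicit function theorem (`IsAdmissible.exists_jet`). Splitting the resulting identity
with respect to the free derivatives gives, in turn, `T = T(t)` (`IsAdmissible.tComp_time`),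
`X = X(t,x)` and `f' T_t = f X_x ^ 2` (`IsAdmissible.xComp_fiber`), and three determining equations
for `V` (`IsAdmissible.determining_eqs`).

The decisive point is that `V` is affine in `v`. The reciprocal `w = 1 / V_v` satisfies
`f w_v = b - w` with `b = T_t / X_x ^ 2`, and the other determining equations turn into
`b_x = f_x w_v` and `w_t + f w_xx = 0`. Where `w ≠ b`, differentiating in `v` forces
`f_x = f_t = 0`, which is impossible as `f` is constant on no open set
(`DeterminingSystem.f_constant`). Hence `w = b`; then `V_v` is a constant `c₀`, `X` is affine in
`x`, and the drift `m = X_t / X_x` is affine in `x` and satisfies `m_t = (m - f_x) m_x`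
(`IsAdmissible.first_derivatives`). Solving these equations amounts to observing that certain
expressions have vanishing partial derivatives; they are therefore constant on the connected source,
and their values are the constants `c₁, …, c₆` (`IsAdmissible.exists_hasForm`). No convexity of the
source in `x` is needed.

Conversely, for a transformation of this form the chain rule shows that the left-hand sides of the
two equations are proportional (`HasForm.mapsEquation`), and the formulas define a diffeomorphism
over every interval where they make sense (`IsRegularInterval.exists_transformation`). Thus
admissible transformations of equations of the subclass are exactly the transformations of the
stated form, and since admissibility is preserved by inversion (`IsAdmissible.symm`) and composition
(`IsAdmissible.trans_restr`), so is the form.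
-/

/-! ### Partial derivatives of functions of `(t,x,v)` -/

/-- The linear form with the coefficients `a`, `b`, `c` on the space of `(t,x,v)`. -/
noncomputable def linForm (a b c : ℝ) : ℝ × ℝ × ℝ →L[ℝ] ℝ :=
  a • ContinuousLinearMap.fst ℝ ℝ (ℝ × ℝ) +
    b • (ContinuousLinearMap.fst ℝ ℝ ℝ).comp (ContinuousLinearMap.snd ℝ ℝ (ℝ × ℝ)) +
    c • (ContinuousLinearMap.snd ℝ ℝ ℝ).comp (ContinuousLinearMap.snd ℝ ℝ (ℝ × ℝ))

@[simp]
theorem linForm_apply (a b c : ℝ) (u : ℝ × ℝ × ℝ) :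
    linForm a b c u = a * u.1 + b * u.2.1 + c * u.2.2 := by
  simp [linForm]

/-- The function `g` of `(t,x,v)` is differentiable at `q`, with the partial derivatives
`a`, `b`, `c` with respect to `t`, `x`, `v`. -/
def HasPartials (g : ℝ × ℝ × ℝ → ℝ) (a b c : ℝ) (q : ℝ × ℝ × ℝ) : Prop :=
  HasFDerivAt g (linForm a b c) q

/-- The partial derivative `∂g/∂t`. -/
noncomputable def dt (g : ℝ × ℝ × ℝ → ℝ) (q : ℝ × ℝ × ℝ) : ℝ := fderiv ℝ g q (1, 0, 0)

/-- The partial derivative `∂g/∂x`. -/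
noncomputable def dx (g : ℝ × ℝ × ℝ → ℝ) (q : ℝ × ℝ × ℝ) : ℝ := fderiv ℝ g q (0, 1, 0)

/-- The partial derivative `∂g/∂v`. -/
noncomputable def dv (g : ℝ × ℝ × ℝ → ℝ) (q : ℝ × ℝ × ℝ) : ℝ := fderiv ℝ g q (0, 0, 1)

section Calculus

variable {g h : ℝ × ℝ × ℝ → ℝ} {a b c a' b' c' : ℝ} {q : ℝ × ℝ × ℝ}

theorem DifferentiableAt.hasPartials (hg : DifferentiableAt ℝ g q) :
    HasPartials g (dt g q) (dx g q) (dv g q) q := by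
  have : linForm (dt g q) (dx g q) (dv g q) = fderiv ℝ g q := by
    ext
    · simp [dt, ← Prod.zero_eq_mk]
    · simp [dx]
    · simp [dv]
  unfold HasPartials
  rw [this]
  exact hg.hasFDerivAt

theorem ContDiffAt.hasPartials {n : WithTop ℕ∞} (hg : ContDiffAt ℝ n g q) (hn : n ≠ 0) :
    HasPartials g (dt g q) (dx g q) (dv g q) q :=
  (hg.differentiableAt hn).hasPartials

namespace HasPartials

theorem dt_eq (hg : HasPartials g a b c q) : dt g q = a := by
  unfold HasPartials at hg
  simp [dt, hg.fderiv]

theorem dx_eq (hg : HasPartials g a b c q) : dx g q = b := by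
  unfold HasPartials at hg
  simp [dx, hg.fderiv]

theorem dv_eq (hg : HasPartials g a b c q) : dv g q = c := by
  unfold HasPartials at hg
  simp [dv, hg.fderiv]

theorem congr (hg : HasPartials g a b c q) (e : h =ᶠ[𝓝 q] g) : HasPartials h a b c q :=
  HasFDerivAt.congr_of_eventuallyEq hg e

/-- Functions that agree near a point have the same partial derivatives there. -/
theorem unique (hg : HasPartials g a b c q) (hh : HasPartials h a' b' c' q) (e : g =ᶠ[𝓝 q] h) :
    a = a' ∧ b = b' ∧ c = c' := by
  have := hh.congr e
  exact ⟨hg.dt_eq.symm.trans this.dt_eq, hg.dx_eq.symm.trans this.dx_eq,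
    hg.dv_eq.symm.trans this.dv_eq⟩

theorem const (k : ℝ) (q : ℝ × ℝ × ℝ) : HasPartials (fun _ => k) 0 0 0 q := by
  have : linForm 0 0 0 = 0 := by ext <;> simp
  unfold HasPartials
  rw [this]
  exact hasFDerivAt_const k q

theorem fst (q : ℝ × ℝ × ℝ) : HasPartials (fun r => r.1) 1 0 0 q := by
  have : linForm 1 0 0 = ContinuousLinearMap.fst ℝ ℝ (ℝ × ℝ) := by ext <;> simp
  unfold HasPartials
  rw [this]
  exact hasFDerivAt_fst

theorem snd_fst (q : ℝ × ℝ × ℝ) : HasPartials (fun r => r.2.1) 0 1 0 q := by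
  have : linForm 0 1 0 =
      (ContinuousLinearMap.fst ℝ ℝ ℝ).comp (ContinuousLinearMap.snd ℝ ℝ (ℝ × ℝ)) := by
    ext <;> simp
  unfold HasPartials
  rw [this]
  exact ((ContinuousLinearMap.fst ℝ ℝ ℝ).comp (ContinuousLinearMap.snd ℝ ℝ (ℝ × ℝ))).hasFDerivAt

theorem snd_snd (q : ℝ × ℝ × ℝ) : HasPartials (fun r => r.2.2) 0 0 1 q := by
  have : linForm 0 0 1 =
      (ContinuousLinearMap.snd ℝ ℝ ℝ).comp (ContinuousLinearMap.snd ℝ ℝ (ℝ × ℝ)) := by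
    ext <;> simp
  unfold HasPartials
  rw [this]
  exact ((ContinuousLinearMap.snd ℝ ℝ ℝ).comp (ContinuousLinearMap.snd ℝ ℝ (ℝ × ℝ))).hasFDerivAt

theorem add (hg : HasPartials g a b c q) (hh : HasPartials h a' b' c' q) :
    HasPartials (fun r => g r + h r) (a + a') (b + b') (c + c') q := by
  have : linForm (a + a') (b + b') (c + c') = linForm a b c + linForm a' b' c' := by
    ext <;> simp
  unfold HasPartials
  rw [this]
  exact HasFDerivAt.add hg hh

theorem sub (hg : HasPartials g a b c q) (hh : HasPartials h a' b' c' q) :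
    HasPartials (fun r => g r - h r) (a - a') (b - b') (c - c') q := by
  have : linForm (a - a') (b - b') (c - c') = linForm a b c - linForm a' b' c' := by
    ext <;> simp
  unfold HasPartials
  rw [this]
  exact HasFDerivAt.sub hg hh

theorem neg (hg : HasPartials g a b c q) : HasPartials (fun r => -g r) (-a) (-b) (-c) q := by
  simpa using (const 0 q).sub hg

theorem mul (hg : HasPartials g a b c q) (hh : HasPartials h a' b' c' q) :
    HasPartials (fun r => g r * h r) (a * h q + g q * a') (b * h q + g q * b')
      (c * h q + g q * c') q := by
  have : linForm (a * h q + g q * a') (b * h q + g q * b') (c * h q + g q * c') =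
      g q • linForm a' b' c' + h q • linForm a b c := by
    ext <;> simp <;> ring
  unfold HasPartials
  rw [this]
  exact HasFDerivAt.mul hg hh

theorem const_mul (k : ℝ) (hg : HasPartials g a b c q) :
    HasPartials (fun r => k * g r) (k * a) (k * b) (k * c) q := by
  simpa using (const k q).mul hg

theorem sq (hg : HasPartials g a b c q) :
    HasPartials (fun r => g r ^ 2) (2 * g q * a) (2 * g q * b) (2 * g q * c) q := by
  have := hg.mul hg
  convert this using 1
  · funext r; ring
  all_goals ring

/-- A function of one variable composed with a function of `(t,x,v)`. -/
theorem comp_deriv {F : ℝ → ℝ} {F' : ℝ} (hF : HasDerivAt F F' (g q))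
    (hg : HasPartials g a b c q) :
    HasPartials (fun r => F (g r)) (F' * a) (F' * b) (F' * c) q := by
  have : linForm (F' * a) (F' * b) (F' * c) = F' • linForm a b c := by
    ext <;> simp
  unfold HasPartials
  rw [this]
  exact hF.comp_hasFDerivAt q hg

/-- A function of `t` only. -/
theorem of_time {F : ℝ → ℝ} {F' : ℝ} (hF : HasDerivAt F F' q.1) :
    HasPartials (fun r => F r.1) F' 0 0 q := by
  simpa using comp_deriv (g := fun r => r.1) hF (fst q)

theorem inv (hg : HasPartials g a b c q) (h0 : g q ≠ 0) :
    HasPartials (fun r => (g r)⁻¹) (-a / g q ^ 2) (-b / g q ^ 2) (-c / g q ^ 2) q := by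
  have := comp_deriv (hasDerivAt_inv h0) hg
  convert this using 1 <;> ring

theorem div (hg : HasPartials g a b c q) (hh : HasPartials h a' b' c' q) (h0 : h q ≠ 0) :
    HasPartials (fun r => g r / h r) ((a * h q - g q * a') / h q ^ 2)
      ((b * h q - g q * b') / h q ^ 2) ((c * h q - g q * c') / h q ^ 2) q := by
  have := hg.mul (hh.inv h0)
  convert this using 1 <;> field_simp <;> ring

/-- The chain rule for a change of all three variables. -/
theorem comp {A B C : ℝ × ℝ × ℝ → ℝ} {a₁ b₁ c₁ a₂ b₂ c₂ a₃ b₃ c₃ : ℝ}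
    (hg : HasPartials g a b c (A q, B q, C q)) (hA : HasPartials A a₁ b₁ c₁ q)
    (hB : HasPartials B a₂ b₂ c₂ q) (hC : HasPartials C a₃ b₃ c₃ q) :
    HasPartials (fun r => g (A r, B r, C r)) (a * a₁ + b * a₂ + c * a₃)
      (a * b₁ + b * b₂ + c * b₃) (a * c₁ + b * c₂ + c * c₃) q := by
  have key := HasFDerivAt.comp (f := fun r => (A r, B r, C r)) q hg
    (HasFDerivAt.prodMk hA (HasFDerivAt.prodMk hB hC))
  have : linForm (a * a₁ + b * a₂ + c * a₃) (a * b₁ + b * b₂ + c * b₃)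
      (a * c₁ + b * c₂ + c * c₃) = (linForm a b c).comp
        ((linForm a₁ b₁ c₁).prod ((linForm a₂ b₂ c₂).prod (linForm a₃ b₃ c₃))) := by
    ext <;> simp
  unfold HasPartials
  rw [this]
  exact key

theorem cast (hg : HasPartials g a b c q) (ha : a = a') (hb : b = b') (hc : c = c') :
    HasPartials g a' b' c' q := by
  rw [← ha, ← hb, ← hc]; exact hg

end HasPartials

theorem dx_congr (e : g =ᶠ[𝓝 q] h) : dx g q = dx h q := by unfold dx; rw [e.fderiv_eq]

section Smooth

theorem ContDiffAt.smooth_fderiv_apply (hg : ContDiffAt ℝ ∞ g q) (u : ℝ × ℝ × ℝ) :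
    ContDiffAt ℝ ∞ (fun r => fderiv ℝ g r u) q :=
  (hg.fderiv_right (m := ∞) (by simp)).clm_apply contDiffAt_const

theorem ContDiffAt.smooth_dt (hg : ContDiffAt ℝ ∞ g q) : ContDiffAt ℝ ∞ (dt g) q :=
  hg.smooth_fderiv_apply _

theorem ContDiffAt.smooth_dx (hg : ContDiffAt ℝ ∞ g q) : ContDiffAt ℝ ∞ (dx g) q :=
  hg.smooth_fderiv_apply _

theorem ContDiffAt.smooth_dv (hg : ContDiffAt ℝ ∞ g q) : ContDiffAt ℝ ∞ (dv g) q :=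
  hg.smooth_fderiv_apply _

theorem ContDiffAt.smooth_hasPartials (hg : ContDiffAt ℝ ∞ g q) :
    HasPartials g (dt g q) (dx g q) (dv g q) q :=
  hg.hasPartials (by simp)

theorem ContDiffAt.eventually_hasPartials (hg : ContDiffAt ℝ ∞ g q) :
    ∀ᶠ r in 𝓝 q, HasPartials g (dt g r) (dx g r) (dv g r) r := by
  have h1 : ContDiffAt ℝ 1 g q := hg.of_le (by exact_mod_cast le_top)
  filter_upwards [h1.eventually (by simp)] with r hr
  exact hr.hasPartials one_ne_zero

theorem ContDiffAt.fderiv_comm (hg : ContDiffAt ℝ ∞ g q) (u w : ℝ × ℝ × ℝ) :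
    fderiv ℝ (fun r => fderiv ℝ g r u) q w = fderiv ℝ (fun r => fderiv ℝ g r w) q u := by
  have h2 : DifferentiableAt ℝ (fderiv ℝ g) q :=
    (hg.fderiv_right (m := ∞) (by simp)).differentiableAt (by simp)
  have hs := hg.isSymmSndFDerivAt (by simpa using (ENat.LEInfty.out : (2 : WithTop ℕ∞) ≤ ∞)) u w
  rw [fderiv_clm_apply h2 (differentiableAt_const u),
    fderiv_clm_apply h2 (differentiableAt_const w)]
  simpa using hs.symm

theorem ContDiffAt.dt_dx (hg : ContDiffAt ℝ ∞ g q) : dt (dx g) q = dx (dt g) q :=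
  hg.fderiv_comm _ _

theorem ContDiffAt.dv_dx (hg : ContDiffAt ℝ ∞ g q) : dv (dx g) q = dx (dv g) q :=
  hg.fderiv_comm _ _

theorem ContDiffAt.dv_dt (hg : ContDiffAt ℝ ∞ g q) : dv (dt g) q = dt (dv g) q :=
  hg.fderiv_comm _ _

end Smooth

/-- A function with vanishing partial derivatives is constant on a connected open set. -/
theorem exists_const_of_hasPartials_zero {S : Set (ℝ × ℝ × ℝ)} (hS : IsOpen S)
    (hc : IsPreconnected S) (h : ∀ q ∈ S, HasPartials g 0 0 0 q) : ∃ k, ∀ q ∈ S, g q = k := by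
  refine hS.exists_is_const_of_fderiv_eq_zero (𝕜 := ℝ) hc
    (fun q hq => HasFDerivAt.differentiableAt (h q hq) |>.differentiableWithinAt) fun q hq => ?_
  have := HasFDerivAt.fderiv (h q hq)
  rw [this]
  ext <;> simp

end Calculus

/-! ### Jets of functions and their transformation -/

theorem contDiff_base : ContDiff ℝ ∞ base := by
  unfold base; fun_prop

theorem continuous_base : Continuous base := contDiff_base.continuous

theorem isOpenMap_base : IsOpenMap base := by
  have h : base = Prod.map id Prod.fst := rfl
  rw [h]
  exact IsOpenMap.id.prodMap isOpenMap_fst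

theorem ContDiffAt.comp_base {v : ℝ × ℝ → ℝ} {q : ℝ × ℝ × ℝ} (hv : ContDiffAt ℝ ∞ v (base q)) :
    ContDiffAt ℝ ∞ (fun r => v (base r)) q :=
  ContDiffAt.comp q hv contDiff_base.contDiffAt

theorem dv_comp_base (v : ℝ × ℝ → ℝ) {q : ℝ × ℝ × ℝ} (hv : ContDiffAt ℝ ∞ v (base q)) :
    dv (fun r => v (base r)) q = 0 := by
  have h := hv.comp_base.smooth_hasPartials
  have h2 := HasPartials.comp (A := fun r => r.1) (B := fun r => r.2.1) (C := fun _ => q.2.2)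
    h (HasPartials.fst q) (HasPartials.snd_fst q) (HasPartials.const _ q)
  have := h2.dv_eq
  simpa [base] using this

/-- The chain rule along a curve. -/
theorem HasPartials.comp_hasDerivAt {g : ℝ × ℝ × ℝ → ℝ} {a b c : ℝ} {γ : ℝ → ℝ × ℝ × ℝ}
    {γ' : ℝ × ℝ × ℝ} {s : ℝ} (hg : HasPartials g a b c (γ s)) (hγ : HasDerivAt γ γ' s) :
    HasDerivAt (fun s => g (γ s)) (a * γ'.1 + b * γ'.2.1 + c * γ'.2.2) s := by
  have : HasFDerivAt g (linForm a b c) (γ s) := hg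
  have h := this.comp_hasDerivAt s hγ
  rw [linForm_apply] at h
  exact h

theorem HasPartials.hasDerivAt_fst {g : ℝ × ℝ × ℝ → ℝ} {a b c : ℝ} {q : ℝ × ℝ × ℝ}
    (hg : HasPartials g a b c q) : HasDerivAt (fun s => g (s, q.2.1, q.2.2)) a q.1 := by
  have hγ : HasDerivAt (fun s : ℝ => (s, q.2.1, q.2.2)) ((1 : ℝ), (0 : ℝ), (0 : ℝ)) q.1 :=
    (hasDerivAt_id _).prodMk ((hasDerivAt_const _ _).prodMk (hasDerivAt_const _ _))
  simpa using HasPartials.comp_hasDerivAt (γ := fun s : ℝ => (s, q.2.1, q.2.2)) hg hγ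

theorem HasPartials.hasDerivAt_snd {g : ℝ × ℝ × ℝ → ℝ} {a b c : ℝ} {q : ℝ × ℝ × ℝ}
    (hg : HasPartials g a b c q) : HasDerivAt (fun y => g (q.1, y, q.2.2)) b q.2.1 := by
  have hγ : HasDerivAt (fun y : ℝ => (q.1, y, q.2.2)) ((0 : ℝ), (1 : ℝ), (0 : ℝ)) q.2.1 :=
    (hasDerivAt_const _ _).prodMk ((hasDerivAt_id _).prodMk (hasDerivAt_const _ _))
  simpa using HasPartials.comp_hasDerivAt (γ := fun y : ℝ => (q.1, y, q.2.2)) hg hγ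

theorem deriv_snd_eq_dx {v : ℝ × ℝ → ℝ} {q : ℝ × ℝ × ℝ} (hv : ContDiffAt ℝ ∞ v (base q)) :
    deriv (fun y => v (q.1, y)) q.2.1 = dx (fun r => v (base r)) q :=
  hv.comp_base.smooth_hasPartials.hasDerivAt_snd.deriv

theorem iteratedDeriv_two_eq_dx_dx {v : ℝ × ℝ → ℝ} {q : ℝ × ℝ × ℝ}
    (hv : ContDiffAt ℝ ∞ v (base q)) :
    iteratedDeriv 2 (fun y => v (q.1, y)) q.2.1 = dx (dx (fun r => v (base r))) q := by
  have hw := hv.comp_base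
  rw [iteratedDeriv_succ, iteratedDeriv_one]
  have hγ : Tendsto (fun y : ℝ => (q.1, y, q.2.2)) (𝓝 q.2.1) (𝓝 q) :=
    (by fun_prop : Continuous fun y : ℝ => (q.1, y, q.2.2)).tendsto' _ _ rfl
  have e : deriv (fun y => v (q.1, y)) =ᶠ[𝓝 q.2.1]
      fun y => dx (fun r => v (base r)) (q.1, y, q.2.2) := by
    filter_upwards [hγ.eventually hw.eventually_hasPartials] with y hy
    exact hy.hasDerivAt_snd.deriv
  rw [e.deriv_eq]
  exact hw.smooth_dx.smooth_hasPartials.hasDerivAt_snd.deriv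

theorem satisfiesAt_iff {f v : ℝ × ℝ → ℝ} {q : ℝ × ℝ × ℝ} (hv : ContDiffAt ℝ ∞ v (base q)) :
    SatisfiesAt f v (base q) ↔ dt (fun r => v (base r)) q + dx (fun r => v (base r)) q ^ 2
      + f (base q) * dx (dx (fun r => v (base r))) q = 0 := by
  unfold SatisfiesAt
  have h1 : deriv (fun s => v (s, (base q).2)) (base q).1 = dt (fun r => v (base r)) q :=
    hv.comp_base.smooth_hasPartials.hasDerivAt_fst.deriv
  have h2 := deriv_snd_eq_dx hv
  have h3 := iteratedDeriv_two_eq_dx_dx hv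
  rw [← h2, ← h3, h1]
  rfl

theorem tendsto_graph {v : ℝ × ℝ → ℝ} {q : ℝ × ℝ × ℝ} (hv : ContDiffAt ℝ ∞ v (base q))
    (hq : OnGraph v q) :
    Tendsto (fun r : ℝ × ℝ × ℝ => (r.1, r.2.1, v (base r))) (𝓝 q) (𝓝 q) := by
  have h1 : ContinuousAt (fun r : ℝ × ℝ × ℝ => (r.1, r.2.1, v (base r))) q :=
    continuousAt_fst.prodMk ((continuousAt_fst.comp continuousAt_snd).prodMk
      hv.comp_base.continuousAt)
  have h2 : Tendsto _ (𝓝 q) (𝓝 (q.1, q.2.1, v (base q))) := h1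
  rwa [← show q.2.2 = v (base q) from hq] at h2

/-- The implicit function theorem: near `q`, the zero set of `F` is the graph of a smooth
function of `(t,x)`. -/
theorem exists_onGraph_iff_eq_zero {F : ℝ × ℝ × ℝ → ℝ} {q : ℝ × ℝ × ℝ}
    (hF : ContDiffAt ℝ ∞ F q) (h0 : F q = 0) (hv : dv F q ≠ 0) :
    ∃ v : ℝ × ℝ → ℝ, ContDiffAt ℝ ∞ v (base q) ∧ OnGraph v q ∧
      ∀ᶠ r in 𝓝 q, (OnGraph v r ↔ F r = 0) := by
  set G : (ℝ × ℝ) × ℝ → ℝ := fun z => F (z.1.1, z.1.2, z.2) with hG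
  set u : (ℝ × ℝ) × ℝ := (base q, q.2.2) with hu
  have hassoc : ContDiff ℝ ∞ (fun z : (ℝ × ℝ) × ℝ => (z.1.1, z.1.2, z.2)) := by fun_prop
  have cG : ContDiffAt ℝ ∞ G u :=
    ContDiffAt.comp u (f := fun z : (ℝ × ℝ) × ℝ => (z.1.1, z.1.2, z.2)) (g := F) hF
      hassoc.contDiffAt
  have hGu : G u = 0 := h0
  have hder : ∀ y : ℝ, (fderiv ℝ G u).comp (ContinuousLinearMap.inr ℝ (ℝ × ℝ) ℝ) y
      = dv F q * y := by
    intro y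
    have h1 : HasDerivAt (fun s : ℝ => G (base q, q.2.2 + s * y)) (fderiv ℝ G u (0, y)) 0 := by
      have hd : HasDerivAt (fun s : ℝ => (base q, q.2.2 + s * y)) ((0 : ℝ × ℝ), y) 0 := by
        refine (hasDerivAt_const _ _).prodMk ?_
        simpa using ((hasDerivAt_id (0 : ℝ)).mul_const y).const_add q.2.2
      have hg := (cG.differentiableAt (by simp)).hasFDerivAt
      have hg' : HasFDerivAt G (fderiv ℝ G u) ((fun s : ℝ => (base q, q.2.2 + s * y)) 0) := by
        simpa [hu] using hg
      exact hg'.comp_hasDerivAt 0 hd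
    have h2 : HasDerivAt (fun s : ℝ => G (base q, q.2.2 + s * y)) (dv F q * y) 0 := by
      have hd : HasDerivAt (fun s : ℝ => (q.1, q.2.1, q.2.2 + s * y)) ((0 : ℝ), (0 : ℝ), y) 0 := by
        refine (hasDerivAt_const _ _).prodMk ((hasDerivAt_const _ _).prodMk ?_)
        simpa using ((hasDerivAt_id (0 : ℝ)).mul_const y).const_add q.2.2
      have hg : HasPartials F (dt F q) (dx F q) (dv F q)
          ((fun s : ℝ => (q.1, q.2.1, q.2.2 + s * y)) 0) := by
        simpa using hF.smooth_hasPartials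
      have := hg.comp_hasDerivAt hd
      simp only [mul_zero, zero_add] at this
      exact this
    simpa using h1.unique h2
  have hinv : ((fderiv ℝ G u).comp (ContinuousLinearMap.inr ℝ (ℝ × ℝ) ℝ)).IsInvertible := by
    refine ⟨ContinuousLinearEquiv.unitsEquivAut ℝ (Units.mk0 (dv F q) hv), ?_⟩
    ext
    have := hder 1
    simp at this ⊢
    exact this.symm
  refine ⟨cG.implicitFunction (by simp) hinv, cG.contDiffAt_implicitFunction (by simp) hinv,
    (cG.implicitFunction_apply_self (by simp) hinv).symm, ?_⟩
  have hev := cG.eventually_apply_eq_iff_implicitFunction (by simp) hinv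
  have ht : Tendsto (fun r : ℝ × ℝ × ℝ => (base r, r.2.2)) (𝓝 q) (𝓝 u) :=
    (by unfold base; fun_prop : Continuous fun r : ℝ × ℝ × ℝ => (base r, r.2.2)).tendsto' _ _ rfl
  filter_upwards [ht.eventually hev] with r hr
  rw [hGu] at hr
  constructor
  · intro h
    exact hr.2 h.symm
  · intro h
    exact (hr.1 h).symm

/-- The total derivatives of `g (t, x, v)` along the graph of `w`. -/
theorem HasPartials.graph {g w : ℝ × ℝ × ℝ → ℝ} {a b c a' b' c' : ℝ} {q : ℝ × ℝ × ℝ}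
    (hg : HasPartials g a b c (q.1, q.2.1, w q)) (hw : HasPartials w a' b' c' q) :
    HasPartials (fun r => g (r.1, r.2.1, w r)) (a + c * a') (b + c * b') (c * c') q := by
  have := HasPartials.comp (A := fun r => r.1) (B := fun r => r.2.1) hg (HasPartials.fst q)
    (HasPartials.snd_fst q) hw
  exact this.cast (by ring) (by ring) (by ring)

/-- If the map `(T,X,V)` sends the graph of `w` into the graph of `w'`, then the first derivatives
and the second `x`-derivatives of `w` and `w'` are related by the chain rule. Here `w'` is
evaluated at `(T,X,0)`, since functions of `(t,x)` are treated as functions of `(t,x,v)`. -/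
theorem jet_relations {T X V w w' : ℝ × ℝ × ℝ → ℝ} {q : ℝ × ℝ × ℝ}
    (hT : ContDiffAt ℝ ∞ T q) (hX : ContDiffAt ℝ ∞ X q) (hV : ContDiffAt ℝ ∞ V q)
    (hw : ContDiffAt ℝ ∞ w q) (hw' : ContDiffAt ℝ ∞ w' (T q, X q, 0)) (hq : w q = q.2.2)
    (e : ∀ᶠ r in 𝓝 q, V (r.1, r.2.1, w r) =
      w' (T (r.1, r.2.1, w r), X (r.1, r.2.1, w r), 0)) :
    (dt V q + dv V q * dt w q = dt w' (T q, X q, 0) * (dt T q + dv T q * dt w q)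
      + dx w' (T q, X q, 0) * (dt X q + dv X q * dt w q)) ∧
    (dx V q + dv V q * dx w q = dt w' (T q, X q, 0) * (dx T q + dv T q * dx w q)
      + dx w' (T q, X q, 0) * (dx X q + dv X q * dx w q)) ∧
    (dx (dx V) q + 2 * dx (dv V) q * dx w q + dv (dv V) q * dx w q ^ 2 + dv V q * dx (dx w) q =
      dt w' (T q, X q, 0) * (dx (dx T) q + 2 * dx (dv T) q * dx w q
        + dv (dv T) q * dx w q ^ 2 + dv T q * dx (dx w) q)
      + dx w' (T q, X q, 0) * (dx (dx X) q + 2 * dx (dv X) q * dx w q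
        + dv (dv X) q * dx w q ^ 2 + dv X q * dx (dx w) q)
      + dt (dt w') (T q, X q, 0) * (dx T q + dv T q * dx w q) ^ 2
      + 2 * dx (dt w') (T q, X q, 0) * (dx T q + dv T q * dx w q) * (dx X q + dv X q * dx w q)
      + dx (dx w') (T q, X q, 0) * (dx X q + dv X q * dx w q) ^ 2) := by
  have hqq : (q.1, q.2.1, w q) = q := by rw [hq]
  have hΓ : Tendsto (fun r : ℝ × ℝ × ℝ => (r.1, r.2.1, w r)) (𝓝 q) (𝓝 q) := by
    have h1 : ContinuousAt (fun r : ℝ × ℝ × ℝ => (r.1, r.2.1, w r)) q :=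
      continuousAt_fst.prodMk ((continuousAt_fst.comp continuousAt_snd).prodMk hw.continuousAt)
    have h2 : Tendsto _ (𝓝 q) (𝓝 (q.1, q.2.1, w q)) := h1
    rwa [hqq] at h2
  have hΦ : Tendsto (fun r : ℝ × ℝ × ℝ =>
      (T (r.1, r.2.1, w r), X (r.1, r.2.1, w r), (0 : ℝ))) (𝓝 q) (𝓝 (T q, X q, 0)) :=
    ((hT.continuousAt.tendsto.comp hΓ).prodMk_nhds
      ((hX.continuousAt.tendsto.comp hΓ).prodMk_nhds tendsto_const_nhds))
  -- the first derivatives of both sides agree at all points near `q`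
  have first : ∀ᶠ r in 𝓝 q,
      (dt V (r.1, r.2.1, w r) + dv V (r.1, r.2.1, w r) * dt w r =
        dt w' (T (r.1, r.2.1, w r), X (r.1, r.2.1, w r), 0) *
          (dt T (r.1, r.2.1, w r) + dv T (r.1, r.2.1, w r) * dt w r)
        + dx w' (T (r.1, r.2.1, w r), X (r.1, r.2.1, w r), 0) *
          (dt X (r.1, r.2.1, w r) + dv X (r.1, r.2.1, w r) * dt w r)) ∧
      (dx V (r.1, r.2.1, w r) + dv V (r.1, r.2.1, w r) * dx w r =
        dt w' (T (r.1, r.2.1, w r), X (r.1, r.2.1, w r), 0) *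
          (dx T (r.1, r.2.1, w r) + dv T (r.1, r.2.1, w r) * dx w r)
        + dx w' (T (r.1, r.2.1, w r), X (r.1, r.2.1, w r), 0) *
          (dx X (r.1, r.2.1, w r) + dv X (r.1, r.2.1, w r) * dx w r)) := by
    filter_upwards [e.eventually_nhds, hΓ.eventually hT.eventually_hasPartials,
      hΓ.eventually hX.eventually_hasPartials, hΓ.eventually hV.eventually_hasPartials,
      hw.eventually_hasPartials, hΦ.eventually hw'.eventually_hasPartials]
      with r er rT rX rV rw rw'
    have l := rV.graph rw
    have m := HasPartials.comp rw' (rT.graph rw) (rX.graph rw) (HasPartials.const 0 r)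
    obtain ⟨e1, e2, -⟩ := l.unique m er
    exact ⟨by linear_combination e1, by linear_combination e2⟩
  have at_q := first.self_of_nhds
  rw [hqq] at at_q
  refine ⟨at_q.1, at_q.2, ?_⟩
  have gw := hw.smooth_hasPartials
  have gp := hw.smooth_dx.smooth_hasPartials
  have G : ∀ {g : ℝ × ℝ × ℝ → ℝ}, ContDiffAt ℝ ∞ g q →
      HasPartials (fun r => g (r.1, r.2.1, w r)) (dt g q + dv g q * dt w q)
        (dx g q + dv g q * dx w q) (dv g q * dv w q) q := by
    intro g hg
    have := hg.smooth_hasPartials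
    rw [← hqq] at this
    have := this.graph gw
    rwa [hqq] at this
  have P : ∀ {g : ℝ × ℝ × ℝ → ℝ}, ContDiffAt ℝ ∞ g (T q, X q, 0) →
      ∃ a c, HasPartials (fun r => g (T (r.1, r.2.1, w r), X (r.1, r.2.1, w r), 0)) a
        (dt g (T q, X q, 0) * (dx T q + dv T q * dx w q)
          + dx g (T q, X q, 0) * (dx X q + dv X q * dx w q)) c q := by
    intro g hg
    have := hg.smooth_hasPartials
    rw [show (T q, X q, (0 : ℝ)) = (T (q.1, q.2.1, w q), X (q.1, q.2.1, w q), (0 : ℝ)) by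
      rw [hqq]] at this
    have := HasPartials.comp (A := fun r => T (r.1, r.2.1, w r))
      (B := fun r => X (r.1, r.2.1, w r)) this (G hT) (G hX) (HasPartials.const 0 q)
    exact ⟨_, _, this.cast rfl (by simp only [hqq]; ring) rfl⟩
  have L := (G hV.smooth_dx).add ((G hV.smooth_dv).mul gp)
  obtain ⟨_, _, P₁⟩ := P hw'.smooth_dt
  obtain ⟨_, _, P₂⟩ := P hw'.smooth_dx
  have R := (P₁.mul ((G hT.smooth_dx).add ((G hT.smooth_dv).mul gp))).add
    (P₂.mul ((G hX.smooth_dx).add ((G hX.smooth_dv).mul gp)))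
  have key := (L.unique R (first.mono fun r hr => hr.2)).2.1
  simp only [hqq] at key
  rw [hV.dv_dx, hT.dv_dx, hX.dv_dx, hw'.dt_dx] at key
  linear_combination key

/-! ### Determining equations of admissible transformations -/

/-- The `t`-component of a local map. -/
def tComp (φ : LocalMap) (r : ℝ × ℝ × ℝ) : ℝ := (φ r).1

/-- The `x`-component of a local map. -/
def xComp (φ : LocalMap) (r : ℝ × ℝ × ℝ) : ℝ := (φ r).2.1

/-- The `v`-component of a local map. -/
def vComp (φ : LocalMap) (r : ℝ × ℝ × ℝ) : ℝ := (φ r).2.2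

section Components

variable {E E' : PotBurgers} {φ : LocalMap} {q : ℝ × ℝ × ℝ}

theorem IsPointTransformation.contDiffAt (h : IsPointTransformation E φ E') (hq : q ∈ φ.source) :
    ContDiffAt ℝ ∞ φ q :=
  h.contDiffOn.contDiffAt (φ.open_source.mem_nhds hq)

theorem IsPointTransformation.smooth_tComp (h : IsPointTransformation E φ E')
    (hq : q ∈ φ.source) : ContDiffAt ℝ ∞ (tComp φ) q :=
  contDiffAt_fst.comp q (h.contDiffAt hq)

theorem IsPointTransformation.smooth_xComp (h : IsPointTransformation E φ E')
    (hq : q ∈ φ.source) : ContDiffAt ℝ ∞ (xComp φ) q :=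
  contDiffAt_fst.comp q (contDiffAt_snd.comp q (h.contDiffAt hq))

theorem IsPointTransformation.smooth_vComp (h : IsPointTransformation E φ E')
    (hq : q ∈ φ.source) : ContDiffAt ℝ ∞ (vComp φ) q :=
  contDiffAt_snd.comp q (contDiffAt_snd.comp q (h.contDiffAt hq))

theorem IsPointTransformation.symm (h : IsPointTransformation E φ E') :
    IsPointTransformation E' φ.symm E where
  contDiffOn := h.contDiffOn_symm
  contDiffOn_symm := by simpa using h.contDiffOn
  isConnected_source := by
    have : φ.symm.source = φ '' φ.source := by
      rw [φ.symm_source, φ.image_source_eq_target]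
    rw [this]
    exact h.isConnected_source.image _ φ.continuousOn
  source_subset := h.target_subset
  target_subset := h.source_subset

/-- The rows of the Jacobian matrix of a point transformation have no common kernel. -/
theorem IsPointTransformation.jacobian_injective (h : IsPointTransformation E φ E')
    (hq : q ∈ φ.source) {a b c : ℝ}
    (h1 : dt (tComp φ) q * a + dx (tComp φ) q * b + dv (tComp φ) q * c = 0)
    (h2 : dt (xComp φ) q * a + dx (xComp φ) q * b + dv (xComp φ) q * c = 0)
    (h3 : dt (vComp φ) q * a + dx (vComp φ) q * b + dv (vComp φ) q * c = 0) :
    a = 0 ∧ b = 0 ∧ c = 0 := by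
  have hq' : φ q ∈ φ.symm.source := φ.map_source hq
  have gT := (h.smooth_tComp hq).smooth_hasPartials
  have gX := (h.smooth_xComp hq).smooth_hasPartials
  have gV := (h.smooth_vComp hq).smooth_hasPartials
  have near : ∀ᶠ r in 𝓝 q, φ.symm (tComp φ r, xComp φ r, vComp φ r) = r := by
    filter_upwards [φ.open_source.mem_nhds hq] with r hr using φ.left_inv hr
  have e1 := HasPartials.unique (HasPartials.comp (g := tComp φ.symm)
    (h.symm.smooth_tComp hq').smooth_hasPartials gT gX gV) (HasPartials.fst q)
    (near.mono fun r hr => congrArg Prod.fst hr)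
  have e2 := HasPartials.unique (HasPartials.comp (g := xComp φ.symm)
    (h.symm.smooth_xComp hq').smooth_hasPartials gT gX gV) (HasPartials.snd_fst q)
    (near.mono fun r hr => congrArg (fun z => z.2.1) hr)
  have e3 := HasPartials.unique (HasPartials.comp (g := vComp φ.symm)
    (h.symm.smooth_vComp hq').smooth_hasPartials gT gX gV) (HasPartials.snd_snd q)
    (near.mono fun r hr => congrArg (fun z => z.2.2) hr)
  obtain ⟨p1, p2, p3⟩ := e1
  obtain ⟨r1, r2, r3⟩ := e2
  obtain ⟨s1, s2, s3⟩ := e3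
  refine ⟨?_, ?_, ?_⟩
  · linear_combination dt (tComp φ.symm) (φ q) * h1 + dx (tComp φ.symm) (φ q) * h2
      + dv (tComp φ.symm) (φ q) * h3 - a * p1 - b * p2 - c * p3
  · linear_combination dt (xComp φ.symm) (φ q) * h1 + dx (xComp φ.symm) (φ q) * h2
      + dv (xComp φ.symm) (φ q) * h3 - a * r1 - b * r2 - c * r3
  · linear_combination dt (vComp φ.symm) (φ q) * h1 + dx (vComp φ.symm) (φ q) * h2
      + dv (vComp φ.symm) (φ q) * h3 - a * s1 - b * s2 - c * s3

/-- The `t`-component of a point transformation has no critical points. -/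
theorem IsPointTransformation.exists_tComp_eq_one (h : IsPointTransformation E φ E')
    (hq : q ∈ φ.source) :
    ∃ a b c, dt (tComp φ) q * a + dx (tComp φ) q * b + dv (tComp φ) q * c = 1 := by
  have hq' : φ q ∈ φ.symm.source := φ.map_source hq
  have gT := (h.symm.smooth_tComp hq').smooth_hasPartials
  have gX := (h.symm.smooth_xComp hq').smooth_hasPartials
  have gV := (h.symm.smooth_vComp hq').smooth_hasPartials
  have near : ∀ᶠ r in 𝓝 (φ q),
      φ (tComp φ.symm r, xComp φ.symm r, vComp φ.symm r) = r := by
    filter_upwards [φ.open_target.mem_nhds hq'] with r hr using φ.right_inv hr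
  have hqq : (tComp φ.symm (φ q), xComp φ.symm (φ q), vComp φ.symm (φ q)) = q := φ.left_inv hq
  have g := (h.smooth_tComp hq).smooth_hasPartials
  rw [← hqq] at g
  have e1 := HasPartials.unique (HasPartials.comp g gT gX gV) (HasPartials.fst (φ q))
    (near.mono fun r hr => congrArg Prod.fst hr)
  rw [hqq] at e1
  exact ⟨_, _, _, e1.1⟩

end Components

theorem PotBurgers.contDiffAt_f (E : PotBurgers) {z : ℝ × ℝ} (hz : z ∈ E.dom) :
    ContDiffAt ℝ ∞ E.f z :=
  E.contDiffOn_f.contDiffAt (E.isOpen_dom.mem_nhds hz)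

theorem partials_eq_zero {g : ℝ × ℝ × ℝ → ℝ} {q : ℝ × ℝ × ℝ} (hg : ∀ᶠ r in 𝓝 q, g r = 0) :
    dt g q = 0 ∧ dx g q = 0 ∧ dv g q = 0 := by
  have : HasPartials g 0 0 0 q := (HasPartials.const 0 q).congr hg
  exact ⟨this.dt_eq, this.dx_eq, this.dv_eq⟩

section Admissible

variable {E E' : PotBurgers} {φ : LocalMap} {q : ℝ × ℝ × ℝ}

/-- For every jet `(α, β, γ)` of a solution of the target equation, and for every value `2 ε` of
its second `t`-derivative, the transformed jet `(s, p, r)` satisfies the source equation. -/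
theorem IsAdmissible.exists_jet (h : IsAdmissible E φ E') (hq : q ∈ φ.source) (α β γ ε : ℝ)
    (hδ : dv (vComp φ) q - α * dv (tComp φ) q - β * dv (xComp φ) q ≠ 0)
    (he : α + β ^ 2 + E'.f (base (φ q)) * γ = 0) :
    ∃ s p r : ℝ,
      (dt (vComp φ) q + dv (vComp φ) q * s = α * (dt (tComp φ) q + dv (tComp φ) q * s)
        + β * (dt (xComp φ) q + dv (xComp φ) q * s)) ∧
      (dx (vComp φ) q + dv (vComp φ) q * p = α * (dx (tComp φ) q + dv (tComp φ) q * p)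
        + β * (dx (xComp φ) q + dv (xComp φ) q * p)) ∧
      (dx (dx (vComp φ)) q + 2 * dx (dv (vComp φ)) q * p + dv (dv (vComp φ)) q * p ^ 2
          + dv (vComp φ) q * r =
        α * (dx (dx (tComp φ)) q + 2 * dx (dv (tComp φ)) q * p + dv (dv (tComp φ)) q * p ^ 2
          + dv (tComp φ) q * r)
        + β * (dx (dx (xComp φ)) q + 2 * dx (dv (xComp φ)) q * p + dv (dv (xComp φ)) q * p ^ 2
          + dv (xComp φ) q * r)
        + 2 * ε * (dx (tComp φ) q + dv (tComp φ) q * p) ^ 2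
        + γ * (dx (xComp φ) q + dv (xComp φ) q * p) ^ 2) ∧
      s + p ^ 2 + E.f (base q) * r = 0 := by
  have hT := h.1.smooth_tComp hq
  have hX := h.1.smooth_xComp hq
  have hV := h.1.smooth_vComp hq
  set T₀ := tComp φ q with hT₀
  set X₀ := xComp φ q with hX₀
  -- a quadratic polynomial with the given jet; its preimage under `φ` is the graph of a function
  -- because `hδ` is the hypothesis of the implicit function theorem
  set v' : ℝ × ℝ → ℝ := fun z => vComp φ q + α * (z.1 - T₀) + β * (z.2 - X₀)
    + γ / 2 * (z.2 - X₀) ^ 2 + ε * (z.1 - T₀) ^ 2 with hv'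
  have sv' : ContDiff ℝ ∞ v' := by fun_prop
  set w' : ℝ × ℝ × ℝ → ℝ := fun r => v' (base r) with hw'
  have sw' : ContDiff ℝ ∞ w' := sv'.comp contDiff_base
  have pw' : ∀ r, HasPartials w' (α + 2 * ε * (r.1 - T₀)) (β + γ * (r.2.1 - X₀)) 0 r := by
    intro r
    have a1 := (HasPartials.fst r).sub (HasPartials.const T₀ r)
    have a2 := (HasPartials.snd_fst r).sub (HasPartials.const X₀ r)
    have := ((((HasPartials.const (vComp φ q) r).add (a1.const_mul α)).add
      (a2.const_mul β)).add (a2.sq.const_mul (γ / 2))).add (a1.sq.const_mul ε)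
    exact this.cast (by ring) (by ring) (by ring)
  have dtw' : dt w' = fun r => α + 2 * ε * (r.1 - T₀) := funext fun r => (pw' r).dt_eq
  have dxw' : dx w' = fun r => β + γ * (r.2.1 - X₀) := funext fun r => (pw' r).dx_eq
  have pdt : ∀ r, HasPartials (dt w') (2 * ε) 0 0 r := by
    intro r
    rw [dtw']
    have := (HasPartials.const α r).add
      (((HasPartials.fst r).sub (HasPartials.const T₀ r)).const_mul (2 * ε))
    exact this.cast (by ring) (by ring) (by ring)
  have pdx : ∀ r, HasPartials (dx w') 0 γ 0 r := by
    intro r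
    rw [dxw']
    have := (HasPartials.const β r).add
      (((HasPartials.snd_fst r).sub (HasPartials.const X₀ r)).const_mul γ)
    exact this.cast (by ring) (by ring) (by ring)
  set F : ℝ × ℝ × ℝ → ℝ := fun r => vComp φ r - w' (tComp φ r, xComp φ r, 0) with hF
  have sF : ContDiffAt ℝ ∞ F q :=
    hV.sub (sw'.contDiffAt.comp q (hT.prodMk (hX.prodMk contDiffAt_const)))
  have hF0 : F q = 0 := by simp [hF, hw', hv', base, hT₀, hX₀]
  have hFv : dv F q ≠ 0 := by
    have g := hV.smooth_hasPartials.sub (HasPartials.comp (pw' (T₀, X₀, 0)) hT.smooth_hasPartials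
      hX.smooth_hasPartials (HasPartials.const 0 q))
    have := g.dv_eq
    simp only [sub_self, mul_zero, add_zero] at this
    rw [hF, this]
    intro h0
    exact hδ (by linear_combination h0)
  obtain ⟨v, sv, hvq, hvF⟩ := exists_onGraph_iff_eq_zero sF hF0 hFv
  have hgraph : ∀ r, OnGraph v' (φ r) ↔ F r = 0 := by
    intro r
    change vComp φ r = w' (tComp φ r, xComp φ r, 0) ↔ _
    rw [hF]
    exact sub_eq_zero.symm
  have hmaps := h.2 q hq v v' sv sv'.contDiffAt hvq ((hgraph q).2 hF0)
    (hvF.mono fun r hr => hr.trans (hgraph r).symm)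
  have hsv' : SatisfiesAt E'.f v' (base (φ q)) := by
    have : base (φ q) = base (T₀, X₀, 0) := rfl
    rw [this, satisfiesAt_iff (q := (T₀, X₀, 0)) sv'.contDiffAt]
    change dt w' _ + dx w' _ ^ 2 + _ * dx (dx w') _ = 0
    rw [(pdx _).dx_eq, dtw', dxw']
    simp only [sub_self, mul_zero, add_zero]
    exact he
  have hsv := (satisfiesAt_iff sv).1 (hmaps.2 hsv')
  have hev : ∀ᶠ r in 𝓝 q, vComp φ (r.1, r.2.1, v (base r)) =
      w' (tComp φ (r.1, r.2.1, v (base r)), xComp φ (r.1, r.2.1, v (base r)), 0) := by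
    filter_upwards [(tendsto_graph sv hvq).eventually hvF] with r hr
    exact sub_eq_zero.1 (hr.1 rfl)
  obtain ⟨j1, j2, j3⟩ := jet_relations hT hX hV sv.comp_base sw'.contDiffAt
    (show v (base q) = q.2.2 from hvq.symm) hev
  rw [(pdx _).dx_eq, (pdt _).dt_eq, (pdt _).dx_eq] at j3
  rw [dtw', dxw'] at j1 j2 j3
  simp only [← hT₀, ← hX₀, sub_self, mul_zero, add_zero, zero_mul] at j1 j2 j3
  exact ⟨_, _, _, j1, j2, by linear_combination j3, hsv⟩

theorem IsAdmissible.f_ne_zero (h : IsAdmissible E φ E') (hq : q ∈ φ.source) :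
    E.f (base q) ≠ 0 :=
  E.f_ne_zero _ (h.1.source_subset q hq)

theorem IsAdmissible.f_target_ne_zero (h : IsAdmissible E φ E') (hq : q ∈ φ.source) :
    E'.f (base (φ q)) ≠ 0 :=
  E'.f_ne_zero _ (h.1.target_subset _ (φ.map_source hq))

/-- The `t`-component of an admissible transformation depends on `t` only: otherwise the second
`t`-derivative of a transformed solution, which the equation leaves free, would enter the
transformed equation. -/
theorem IsAdmissible.tComp_time (h : IsAdmissible E φ E') (hq : q ∈ φ.source) :
    dx (tComp φ) q = 0 ∧ dv (tComp φ) q = 0 := by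
  have hf := h.f_ne_zero hq
  have hf' := h.f_target_ne_zero hq
  have J := h.exists_jet hq
  have inj := fun {a b c} => h.1.jacobian_injective hq (a := a) (b := b) (c := c)
  set f := E.f (base q)
  set f' := E'.f (base (φ q))
  generalize dt (tComp φ) q = Tt at *
  generalize dx (tComp φ) q = Tx at *
  generalize dv (tComp φ) q = Tv at *
  generalize dt (xComp φ) q = Xt at *
  generalize dx (xComp φ) q = Xx at *
  generalize dv (xComp φ) q = Xv at *
  generalize dt (vComp φ) q = Vt at *
  generalize dx (vComp φ) q = Vx at *
  generalize dv (vComp φ) q = Vv at *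
  have key : ∀ α β : ℝ, Vv - α * Tv - β * Xv ≠ 0 →
      (Tx * Vv - Tv * Vx) + β * (Tv * Xx - Tx * Xv) = 0 := by
    intro α β hδ
    have he : α + β ^ 2 + f' * (-(α + β ^ 2) / f') = 0 := by field_simp; ring
    -- the jets transformed with `ε = 0` and `ε = 1` can differ only in `r`, which the source
    -- equation determines by `s` and `p`
    obtain ⟨s₀, p₀, r₀, i₀, j₀, k₀, l₀⟩ := J α β _ 0 hδ he
    obtain ⟨s₁, p₁, r₁, i₁, j₁, k₁, l₁⟩ := J α β _ 1 hδ he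
    have hs : s₁ = s₀ := mul_left_cancel₀ hδ (by linear_combination i₁ - i₀)
    have hp : p₁ = p₀ := mul_left_cancel₀ hδ (by linear_combination j₁ - j₀)
    subst hs hp
    have hr : r₁ = r₀ := mul_left_cancel₀ hf (by linear_combination l₁ - l₀)
    subst hr
    have : Tx + Tv * p₁ = 0 := by
      have : (Tx + Tv * p₁) ^ 2 = 0 := by linear_combination (k₀ - k₁) / 2
      exact pow_eq_zero_iff two_ne_zero |>.1 this
    linear_combination (Vv - α * Tv - β * Xv) * this - Tv * j₁
  -- `key` is affine in `β` and holds wherever the affine function `V_v - α T_v - β X_v` of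
  -- `(α, β)`, which does not vanish identically, is nonzero
  have AB : Tx * Vv - Tv * Vx = 0 ∧ Tv * Xx - Tx * Xv = 0 := by
    by_cases hV : Vv = 0
    · subst hV
      by_cases hX : Xv = 0
      · subst hX
        by_cases hT : Tv = 0
        · subst hT
          have := (inj (a := 0) (b := 0) (c := 1) (by simp) (by simp) (by simp)).2.2
          norm_num at this
        · have k0 := key 1 0 (by simpa using hT)
          have k1 := key 1 1 (by simpa using hT)
          exact ⟨by linear_combination k0, by linear_combination k1 - k0⟩
      · have k0 := key 0 1 (by simpa using hX)
        have k1 := key 0 (-1) (by simpa using hX)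
        exact ⟨by linear_combination (k0 + k1) / 2, by linear_combination (k0 - k1) / 2⟩
    · have k0 := key 0 0 (by simpa using hV)
      refine ⟨by linear_combination k0, ?_⟩
      by_cases hX : Vv = Xv
      · have k1 := key 0 (-1) (by rw [← hX]; intro h0; exact hV (by linear_combination h0 / 2))
        linear_combination k0 - k1
      · have k1 := key 0 1 (by intro h0; exact hX (by linear_combination h0))
        linear_combination k1 - k0
  -- the tangent vector `(0, T_v, -T_x)` is annihilated by the Jacobian matrix
  have := inj (a := 0) (b := Tv) (c := -Tx) (by ring) (by linear_combination AB.2)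
    (by linear_combination -AB.1)
  exact ⟨by linear_combination -this.2.2, this.2.1⟩

theorem IsAdmissible.dt_tComp_ne_zero (h : IsAdmissible E φ E') (hq : q ∈ φ.source) :
    dt (tComp φ) q ≠ 0 := by
  obtain ⟨a, b, c, habc⟩ := h.1.exists_tComp_eq_one hq
  rw [(h.tComp_time hq).1, (h.tComp_time hq).2] at habc
  intro h0
  simp [h0] at habc

/-- The `x`-component does not depend on `v`, and the coefficients of the two equations are
related by `f' T_t = f X_x ^ 2`. -/
theorem IsAdmissible.xComp_fiber (h : IsAdmissible E φ E') (hq : q ∈ φ.source) :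
    dv (xComp φ) q = 0 ∧ dx (xComp φ) q ≠ 0 ∧ dv (vComp φ) q ≠ 0 ∧
      E'.f (base (φ q)) * dt (tComp φ) q = E.f (base q) * dx (xComp φ) q ^ 2 := by
  have hf := h.f_ne_zero hq
  have hf' := h.f_target_ne_zero hq
  have J := h.exists_jet hq
  have inj := fun {a b c} => h.1.jacobian_injective hq (a := a) (b := b) (c := c)
  have hTt := h.dt_tComp_ne_zero hq
  obtain ⟨hTx, hTv⟩ := h.tComp_time hq
  rw [hTx, hTv] at J inj
  have near : ∀ᶠ r in 𝓝 q, dx (tComp φ) r = 0 ∧ dv (tComp φ) r = 0 := by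
    filter_upwards [φ.open_source.mem_nhds hq] with r hr using h.tComp_time hr
  rw [(partials_eq_zero (near.mono fun r hr => hr.1)).2.1,
    (partials_eq_zero (near.mono fun r hr => hr.2)).2.1,
    (partials_eq_zero (near.mono fun r hr => hr.2)).2.2] at J
  set f := E.f (base q)
  set f' := E'.f (base (φ q))
  generalize dt (tComp φ) q = Tt at *
  generalize dt (xComp φ) q = Xt at *
  generalize dx (xComp φ) q = Xx at *
  generalize dv (xComp φ) q = Xv at *
  generalize dt (vComp φ) q = Vt at *
  generalize dx (vComp φ) q = Vx at *
  generalize dv (vComp φ) q = Vv at *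
  have key : ∀ β : ℝ, Vv - β * Xv ≠ 0 →
      f' * Tt * (Vv - β * Xv) ^ 2 = f * (Xx * Vv - Xv * Vx) ^ 2 := by
    intro β hδ
    have hδ' : ∀ α, Vv - α * 0 - β * Xv ≠ 0 := by intro α; simpa using hδ
    have he : ∀ α, α + β ^ 2 + f' * (-(α + β ^ 2) / f') = 0 := by intro α; field_simp; ring
    -- split with respect to `v'_t` by comparing its values `0` and `1`
    obtain ⟨s₀, p₀, r₀, i₀, j₀, k₀, l₀⟩ := J 0 β _ 0 (hδ' 0) (he 0)
    obtain ⟨s₁, p₁, r₁, i₁, j₁, k₁, l₁⟩ := J 1 β _ 0 (hδ' 1) (he 1)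
    have hp : p₁ = p₀ := mul_left_cancel₀ hδ (by linear_combination j₁ - j₀)
    subst hp
    have hs : (Vv - β * Xv) * (s₁ - s₀) = Tt := by linear_combination i₁ - i₀
    have hr : f' * ((Vv - β * Xv) * (r₁ - r₀)) = -(Xx + Xv * p₁) ^ 2 := by
      have e : ∀ α, f' * (-(α + β ^ 2) / f') = -(α + β ^ 2) := by intro α; field_simp
      linear_combination f' * (k₁ - k₀) + (e 1 - e 0) * (Xx + Xv * p₁) ^ 2
    have hN : (Vv - β * Xv) * (Xx + Xv * p₁) = Xx * Vv - Xv * Vx := by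
      linear_combination Xv * j₁
    have hD : f' * Tt = f * (Xx + Xv * p₁) ^ 2 := by
      linear_combination f' * (Vv - β * Xv) * (l₁ - l₀) - f * hr - f' * hs
    rw [← hN, hD]
    ring
  have hXv : Xv = 0 := by
    by_contra hXv
    -- otherwise `key` fails for two values of `β`, at which `V_v - β X_v` is `1` and `2`
    have e1 : Vv - (Vv - 1) / Xv * Xv = 1 := by field_simp; ring
    have e2 : Vv - (Vv - 2) / Xv * Xv = 2 := by field_simp; ring
    have k1 := key ((Vv - 1) / Xv) (by rw [e1]; norm_num)
    have k2 := key ((Vv - 2) / Xv) (by rw [e2]; norm_num)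
    rw [e1] at k1
    rw [e2] at k2
    exact mul_ne_zero hf' hTt (by linear_combination (k2 - k1) / 3)
  subst hXv
  have hVv : Vv ≠ 0 := by
    rintro rfl
    have := (inj (a := 0) (b := 0) (c := 1) (by simp) (by simp) (by simp)).2.2
    norm_num at this
  have k := key 0 (by simpa using hVv)
  have k' : f' * Tt = f * Xx ^ 2 :=
    mul_left_cancel₀ (pow_ne_zero 2 hVv) (by linear_combination k)
  refine ⟨rfl, ?_, hVv, k'⟩
  rintro rfl
  exact mul_ne_zero hf' hTt (by linear_combination k')

/-- The conditions obtained by splitting with respect to `v_x`: the coefficients of its powers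
`0`, `1`, `2`. -/
theorem IsAdmissible.determining_eqs (h : IsAdmissible E φ E') (hq : q ∈ φ.source) :
    (dt (vComp φ) q - dt (xComp φ) q / dx (xComp φ) q * dx (vComp φ) q
      + dt (tComp φ) q / dx (xComp φ) q ^ 2 * dx (vComp φ) q ^ 2
      + E.f (base q) * dx (dx (vComp φ)) q
      - E.f (base q) * (dx (dx (xComp φ)) q / dx (xComp φ) q) * dx (vComp φ) q = 0) ∧
    (2 * E.f (base q) * dx (dv (vComp φ)) q = dv (vComp φ) q * (dt (xComp φ) q / dx (xComp φ) q
      - 2 * (dt (tComp φ) q / dx (xComp φ) q ^ 2) * dx (vComp φ) q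
      + E.f (base q) * (dx (dx (xComp φ)) q / dx (xComp φ) q))) ∧
    (E.f (base q) * dv (dv (vComp φ)) q =
      dv (vComp φ) q - dt (tComp φ) q / dx (xComp φ) q ^ 2 * dv (vComp φ) q ^ 2) := by
  have hf := h.f_ne_zero hq
  have hf' := h.f_target_ne_zero hq
  have J := h.exists_jet hq
  obtain ⟨hTx, hTv⟩ := h.tComp_time hq
  obtain ⟨hXv, hXx, hVv, hff⟩ := h.xComp_fiber hq
  have near : ∀ᶠ r in 𝓝 q, dx (tComp φ) r = 0 ∧ dv (tComp φ) r = 0 ∧ dv (xComp φ) r = 0 := by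
    filter_upwards [φ.open_source.mem_nhds hq] with r hr
    exact ⟨(h.tComp_time hr).1, (h.tComp_time hr).2, (h.xComp_fiber hr).1⟩
  rw [hTx, hTv, hXv, (partials_eq_zero (near.mono fun r hr => hr.1)).2.1,
    (partials_eq_zero (near.mono fun r hr => hr.2.1)).2.1,
    (partials_eq_zero (near.mono fun r hr => hr.2.1)).2.2,
    (partials_eq_zero (near.mono fun r hr => hr.2.2)).2.1,
    (partials_eq_zero (near.mono fun r hr => hr.2.2)).2.2] at J
  set f := E.f (base q)
  set f' := E'.f (base (φ q))
  generalize dt (tComp φ) q = Tt at *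
  generalize dt (xComp φ) q = Xt at *
  generalize dx (xComp φ) q = Xx at *
  generalize dt (vComp φ) q = Vt at *
  generalize dx (vComp φ) q = Vx at *
  generalize dv (vComp φ) q = Vv at *
  generalize dx (dx (xComp φ)) q = Xxx at *
  generalize dx (dx (vComp φ)) q = Vxx at *
  generalize dx (dv (vComp φ)) q = Vxv at *
  generalize dv (dv (vComp φ)) q = Vvv at *
  have key : ∀ p : ℝ, (Vt - Xt / Xx * Vx + Tt / Xx ^ 2 * Vx ^ 2 + f * Vxx - f * (Xxx / Xx) * Vx)
      + p * (2 * f * Vxv - Vv * (Xt / Xx - 2 * (Tt / Xx ^ 2) * Vx + f * (Xxx / Xx)))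
      + p ^ 2 * (f * Vvv - (Vv - Tt / Xx ^ 2 * Vv ^ 2)) = 0 := by
    intro p
    -- the value of `v'_x` for which the transformed derivative `v_x` is `p`
    set β := (Vx + Vv * p) / Xx with hβ
    have hβX : β * Xx = Vx + Vv * p := by rw [hβ]; field_simp
    obtain ⟨s, p', r, i, j, k, l⟩ := J 0 β (-(0 + β ^ 2) / f') 0 (by simpa using hVv)
      (by field_simp; ring)
    have hp : p' = p := mul_left_cancel₀ hVv (by linear_combination j + hβX)
    subst hp
    have e1 : f * (-(0 + β ^ 2) / f' * Xx ^ 2) = -(β ^ 2) * Tt := by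
      field_simp
      linear_combination β ^ 2 * hff
    have e2 : Xt / Xx * Vx + p' * Vv * (Xt / Xx) = β * Xt := by rw [hβ]; field_simp
    have e3 : Xxx / Xx * Vx + p' * Vv * (Xxx / Xx) = β * Xxx := by rw [hβ]; field_simp
    have e4 : Tt / Xx ^ 2 * (Vx + Vv * p') ^ 2 = β ^ 2 * Tt := by rw [hβ]; field_simp
    linear_combination i + f * k - Vv * l - e2 - f * e3 + e4 + e1
  have k0 := key 0
  have k1 := key 1
  have k2 := key (-1)
  exact ⟨by linear_combination k0, by linear_combination (k1 - k2) / 2,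
    by linear_combination (k1 + k2) / 2 - k0⟩

end Admissible

/-! ### Solving the determining equations -/

/-- The determining equations for the `v`-component `V` of an admissible transformation with
`T = T(t)`, `X = X(t,x)`, in terms of `b = T_t / X_x ^ 2`, `m = X_t / X_x` and
`n = X_xx / X_x`. -/
structure DeterminingSystem (S : Set (ℝ × ℝ × ℝ)) (f b m n V : ℝ × ℝ × ℝ → ℝ) : Prop where
  isOpen : IsOpen S
  smooth_f : ∀ q ∈ S, ContDiffAt ℝ ∞ f q
  smooth_b : ∀ q ∈ S, ContDiffAt ℝ ∞ b q
  smooth_m : ∀ q ∈ S, ContDiffAt ℝ ∞ m q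
  smooth_n : ∀ q ∈ S, ContDiffAt ℝ ∞ n q
  smooth_V : ∀ q ∈ S, ContDiffAt ℝ ∞ V q
  dv_f : ∀ q ∈ S, dv f q = 0
  dv_b : ∀ q ∈ S, dv b q = 0
  dv_m : ∀ q ∈ S, dv m q = 0
  dv_n : ∀ q ∈ S, dv n q = 0
  dx_b : ∀ q ∈ S, dx b q = -2 * b q * n q
  f_ne : ∀ q ∈ S, f q ≠ 0
  b_ne : ∀ q ∈ S, b q ≠ 0
  dv_V_ne : ∀ q ∈ S, dv V q ≠ 0
  eq0 : ∀ q ∈ S, dt V q - m q * dx V q + b q * dx V q ^ 2 + f q * dx (dx V) q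
    - f q * n q * dx V q = 0
  eq1 : ∀ q ∈ S, 2 * f q * dx (dv V) q = dv V q * (m q - 2 * b q * dx V q + f q * n q)
  eq2 : ∀ q ∈ S, f q * dv (dv V) q = dv V q - b q * dv V q ^ 2

namespace DeterminingSystem

variable {S : Set (ℝ × ℝ × ℝ)} {f b m n V : ℝ × ℝ × ℝ → ℝ} {q : ℝ × ℝ × ℝ}

theorem near (D : DeterminingSystem S f b m n V) (hq : q ∈ S) : ∀ᶠ r in 𝓝 q, r ∈ S :=
  D.isOpen.mem_nhds hq

/-- The reciprocal `w = 1 / V_v`; it satisfies linear equations. -/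
noncomputable def recip (V : ℝ × ℝ × ℝ → ℝ) (r : ℝ × ℝ × ℝ) : ℝ := (dv V r)⁻¹

theorem recip_mul (D : DeterminingSystem S f b m n V) (hq : q ∈ S) : recip V q * dv V q = 1 :=
  inv_mul_cancel₀ (D.dv_V_ne q hq)

theorem smooth_recip (D : DeterminingSystem S f b m n V) (hq : q ∈ S) :
    ContDiffAt ℝ ∞ (recip V) q :=
  (D.smooth_V q hq).smooth_dv.inv (D.dv_V_ne q hq)

theorem recip_ne (D : DeterminingSystem S f b m n V) (hq : q ∈ S) : recip V q ≠ 0 :=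
  inv_ne_zero (D.dv_V_ne q hq)

theorem hasPartials_recip (D : DeterminingSystem S f b m n V) (hq : q ∈ S) :
    dt (recip V) q = -(recip V q ^ 2 * dt (dv V) q) ∧
    dx (recip V) q = -(recip V q ^ 2 * dx (dv V) q) ∧
    dv (recip V) q = -(recip V q ^ 2 * dv (dv V) q) := by
  have h := (D.smooth_V q hq).smooth_dv.smooth_hasPartials.inv (D.dv_V_ne q hq)
  refine ⟨h.dt_eq.trans ?_, h.dx_eq.trans ?_, h.dv_eq.trans ?_⟩ <;> (unfold recip; ring)

theorem f_mul_dv_recip (D : DeterminingSystem S f b m n V) (hq : q ∈ S) :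
    f q * dv (recip V) q = b q - recip V q := by
  have h1 := D.recip_mul hq
  rw [(D.hasPartials_recip hq).2.2]
  linear_combination -recip V q ^ 2 * D.eq2 q hq
    + (b q * (recip V q * dv V q + 1) - recip V q) * h1

theorem f_mul_dx_recip (D : DeterminingSystem S f b m n V) (hq : q ∈ S) :
    2 * (f q * dx (recip V) q) = -(recip V q * (m q - 2 * (b q * dx V q) + f q * n q)) := by
  have h1 := D.recip_mul hq
  rw [(D.hasPartials_recip hq).2.1]
  linear_combination -recip V q ^ 2 * D.eq1 q hq
    - recip V q * (m q - 2 * b q * dx V q + f q * n q) * h1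

/-- The partial derivatives of `f w_v = b - w`. -/
theorem partials_dv_recip (D : DeterminingSystem S f b m n V) (hq : q ∈ S) :
    (dt f q * dv (recip V) q + f q * dt (dv (recip V)) q = dt b q - dt (recip V) q) ∧
    (dx f q * dv (recip V) q + f q * dx (dv (recip V)) q = dx b q - dx (recip V) q) ∧
    (f q * dv (dv (recip V)) q = -dv (recip V) q) := by
  have hw := D.smooth_recip hq
  have L := (D.smooth_f q hq).smooth_hasPartials.mul hw.smooth_dv.smooth_hasPartials
  have R := (D.smooth_b q hq).smooth_hasPartials.sub hw.smooth_hasPartials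
  obtain ⟨e1, e2, e3⟩ := L.unique R ((D.near hq).mono fun r hr => D.f_mul_dv_recip hr)
  refine ⟨e1, e2, ?_⟩
  rw [D.dv_f q hq, D.dv_b q hq] at e3
  linear_combination e3

/-- The compatibility condition of the equations for `w_v` and `w_x`. -/
theorem dx_b_eq (D : DeterminingSystem S f b m n V) (hq : q ∈ S) :
    dx b q = dx f q * dv (recip V) q := by
  have hw := D.smooth_recip hq
  have hf := (D.smooth_f q hq).smooth_hasPartials
  have hVx := (D.smooth_V q hq).smooth_dx
  have L := (hf.mul hw.smooth_dx.smooth_hasPartials).const_mul 2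
  have R := (hw.smooth_hasPartials.mul (((D.smooth_m q hq).smooth_hasPartials.sub
    (((D.smooth_b q hq).smooth_hasPartials.mul hVx.smooth_hasPartials).const_mul 2)).add
    (hf.mul (D.smooth_n q hq).smooth_hasPartials))).neg
  have e := (L.unique R ((D.near hq).mono fun r hr => D.f_mul_dx_recip hr)).2.2
  rw [D.dv_f q hq, D.dv_m q hq, D.dv_b q hq, D.dv_n q hq, hw.dv_dx,
    (D.smooth_V q hq).dv_dx] at e
  have e2 := (D.partials_dv_recip hq).2.1
  have e3 := D.f_mul_dx_recip hq
  have e4 := (D.hasPartials_recip hq).2.1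
  have e5 := D.f_mul_dv_recip hq
  refine mul_left_cancel₀ (D.recip_ne hq) ?_
  linear_combination (recip V q / 2) * e - dv (recip V) q / 2 * e3 - recip V q * e2
    + b q * e4 + dx (recip V) q * e5

theorem dv_partials_eq_zero {g : ℝ × ℝ × ℝ → ℝ} (hg : ContDiffAt ℝ ∞ g q)
    (h : ∀ᶠ r in 𝓝 q, dv g r = 0) : dv (dt g) q = 0 ∧ dv (dx g) q = 0 := by
  rw [hg.dv_dt, hg.dv_dx]
  exact ⟨(partials_eq_zero h).1, (partials_eq_zero h).2.1⟩

/-- The `v`-derivative of `b_x = f_x w_v`, where `w_v` is the only factor that depends on `v`. -/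
theorem dx_f_mul_eq_zero (D : DeterminingSystem S f b m n V) (hq : q ∈ S) :
    dx f q * dv (recip V) q = 0 := by
  have hw := D.smooth_recip hq
  have L := (D.smooth_b q hq).smooth_dx.smooth_hasPartials
  have R := (D.smooth_f q hq).smooth_dx.smooth_hasPartials.mul hw.smooth_dv.smooth_hasPartials
  have e := (L.unique R ((D.near hq).mono fun r hr => D.dx_b_eq hr)).2.2
  rw [(dv_partials_eq_zero (D.smooth_b q hq) ((D.near hq).mono D.dv_b)).2,
    (dv_partials_eq_zero (D.smooth_f q hq) ((D.near hq).mono D.dv_f)).2] at e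
  have e3 := (D.partials_dv_recip hq).2.2
  linear_combination f q * e + dx f q * e3

theorem dv_recip_ne (D : DeterminingSystem S f b m n V) (hq : q ∈ S) (hne : recip V q ≠ b q) :
    dv (recip V) q ≠ 0 := by
  intro h0
  have := D.f_mul_dv_recip hq
  rw [h0] at this
  exact hne (by linear_combination this)

/-- Where `V` is not affine in `v`, the functions `f` and `b` do not depend on `x`. -/
theorem x_independent (D : DeterminingSystem S f b m n V) (hq : q ∈ S)
    (hne : recip V q ≠ b q) : dx f q = 0 ∧ dx b q = 0 ∧ n q = 0 := by
  have hf : dx f q = 0 :=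
    (mul_eq_zero.1 (D.dx_f_mul_eq_zero hq)).resolve_right (D.dv_recip_ne hq hne)
  have hb : dx b q = 0 := by rw [D.dx_b_eq hq, hf, zero_mul]
  refine ⟨hf, hb, ?_⟩
  have := D.dx_b q hq
  rw [hb] at this
  exact mul_left_cancel₀ (D.b_ne q hq) (by linear_combination this / 2)

theorem near_ne (D : DeterminingSystem S f b m n V) (hq : q ∈ S) (hne : recip V q ≠ b q) :
    ∀ᶠ r in 𝓝 q, r ∈ S ∧ recip V r ≠ b r :=
  (D.near hq).and (((D.smooth_recip hq).continuousAt.ne_iff_eventually_ne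
    (D.smooth_b q hq).continuousAt).1 hne)

/-- Where `V` is not affine in `v`, the reciprocal `w` satisfies the linear heat equation. -/
theorem recip_heat (D : DeterminingSystem S f b m n V) (hq : q ∈ S) (hne : recip V q ≠ b q) :
    dt (recip V) q + f q * dx (dx (recip V)) q = 0 := by
  have hV := D.smooth_V q hq
  have hK := hV.smooth_dv
  have hw := D.smooth_recip hq
  have hx := hV.smooth_dx.smooth_hasPartials
  have L := ((hV.smooth_dt.smooth_hasPartials.sub ((D.smooth_m q hq).smooth_hasPartials.mul
    hx)).add ((D.smooth_b q hq).smooth_hasPartials.mul hx.sq)).add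
    ((D.smooth_f q hq).smooth_hasPartials.mul hV.smooth_dx.smooth_dx.smooth_hasPartials)
  have e := (L.unique (HasPartials.const 0 q) ((D.near_ne hq hne).mono fun r hr => by
    have h0 := D.eq0 r hr.1
    rw [(D.x_independent hr.1 hr.2).2.2] at h0
    linear_combination h0)).2.2
  have hxx : dv (dx (dx V)) q = dx (dx (dv V)) q := by
    rw [hV.smooth_dx.dv_dx]
    exact dx_congr ((D.near hq).mono fun r hr => (D.smooth_V r hr).dv_dx)
  rw [D.dv_m q hq, D.dv_b q hq, D.dv_f q hq, hV.dv_dt, hV.dv_dx, hxx] at e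
  obtain ⟨r1, r2, -⟩ := D.hasPartials_recip hq
  have r3 := ((hw.smooth_dx.smooth_hasPartials).unique
    ((hw.smooth_hasPartials.sq.mul hK.smooth_dx.smooth_hasPartials).neg)
    ((D.near hq).mono fun r hr => (D.hasPartials_recip hr).2.1)).2.1
  have e3 := D.f_mul_dx_recip hq
  rw [(D.x_independent hq hne).2.2] at e3
  rw [r1, r3]
  rw [r2] at e3 ⊢
  have h1 := D.recip_mul hq
  linear_combination -recip V q ^ 2 * e - recip V q * dx (dv V) q * e3

/-- Where `V` is not affine in `v`, the coefficient `f` is locally constant. -/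
theorem f_constant (D : DeterminingSystem S f b m n V) (hq : q ∈ S) (hne : recip V q ≠ b q) :
    dt f q = 0 ∧ dx f q = 0 := by
  -- compatibility of `f w_v = b - w` with the heat equation; differentiated in `v`, it gives
  -- `f_t w_vv = 0`
  have dt_b : ∀ r ∈ S, recip V r ≠ b r → dt b r = dt f r * dv (recip V) r := by
    intro r hr hner
    have hw := D.smooth_recip hr
    have hf := (D.smooth_f r hr).smooth_hasPartials
    have H := hw.smooth_dt.smooth_hasPartials.add
      (hf.mul hw.smooth_dx.smooth_dx.smooth_hasPartials)
    have e1 := (H.unique (HasPartials.const 0 r) ((D.near_ne hr hner).mono fun z hz =>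
      D.recip_heat hz.1 hz.2)).2.2
    have hxx : dv (dx (dx (recip V))) r = dx (dx (dv (recip V))) r := by
      rw [hw.smooth_dx.dv_dx]
      exact dx_congr ((D.near hr).mono fun z hz => (D.smooth_recip hz).dv_dx)
    rw [D.dv_f r hr, hw.dv_dt, hxx] at e1
    have e2 := ((hf.mul hw.smooth_dv.smooth_dx.smooth_hasPartials).unique
      hw.smooth_dx.smooth_hasPartials.neg ((D.near_ne hr hner).mono fun z hz => by
        obtain ⟨h1, h2, -⟩ := D.x_independent hz.1 hz.2
        have := (D.partials_dv_recip hz.1).2.1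
        rw [h1, h2] at this
        linear_combination this)).2.1
    rw [(D.x_independent hr hner).1] at e2
    have e3 := (D.partials_dv_recip hr).1
    have e4 := D.recip_heat hr hner
    linear_combination f r * e1 - f r * e2 - e3 + e4
  refine ⟨?_, (D.x_independent hq hne).1⟩
  have hw := D.smooth_recip hq
  have L := (D.smooth_b q hq).smooth_dt.smooth_hasPartials
  have R := (D.smooth_f q hq).smooth_dt.smooth_hasPartials.mul hw.smooth_dv.smooth_hasPartials
  have e := (L.unique R ((D.near_ne hq hne).mono fun r hr => dt_b r hr.1 hr.2)).2.2
  rw [(dv_partials_eq_zero (D.smooth_b q hq) ((D.near hq).mono D.dv_b)).1,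
    (dv_partials_eq_zero (D.smooth_f q hq) ((D.near hq).mono D.dv_f)).1] at e
  have e3 := (D.partials_dv_recip hq).2.2
  refine (mul_eq_zero.1 ?_).resolve_right (D.dv_recip_ne hq hne)
  linear_combination f q * e + dt f q * e3

/-- If `f` is constant on no open set, then `V_v = 1 / b`. -/
theorem b_mul_dv_V (D : DeterminingSystem S f b m n V)
    (hnc : ∀ q ∈ S, ¬ ∀ᶠ r in 𝓝 q, dt f r = 0 ∧ dx f r = 0) (hq : q ∈ S) :
    b q * dv V q = 1 := by
  by_contra hne
  have hne' : recip V q ≠ b q := by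
    intro h0
    rw [← h0] at hne
    exact hne (D.recip_mul hq)
  exact hnc q hq ((D.near_ne hq hne').mono fun r hr => D.f_constant hr.1 hr.2)

/-- The general solution of the determining equations: `V_v` is constant, and the other derivatives
of `V` are expressed through `m`. -/
theorem solution (D : DeterminingSystem S f b m n V)
    (hnc : ∀ q ∈ S, ¬ ∀ᶠ r in 𝓝 q, dt f r = 0 ∧ dx f r = 0) (hq : q ∈ S) :
    HasPartials (dv V) 0 0 0 q ∧ n q = 0 ∧ dx V q = dv V q * m q / 2 ∧
      dt V q = dv V q * (m q ^ 2 / 4 - f q * dx m q / 2) := by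
  have hbK : ∀ q ∈ S, b q * dv V q = 1 := fun q hq => D.b_mul_dv_V hnc hq
  have hvv : ∀ q ∈ S, dv (dv V) q = 0 := fun q hq => mul_left_cancel₀ (D.f_ne q hq) (by
    linear_combination D.eq2 q hq - dv V q * hbK q hq)
  have hxv : ∀ q ∈ S, dx (dv V) q = 0 := by
    intro q hq
    have hV := D.smooth_V q hq
    have hf := (D.smooth_f q hq).smooth_hasPartials
    have L := (hf.const_mul 2).mul hV.smooth_dv.smooth_dx.smooth_hasPartials
    have R := hV.smooth_dv.smooth_hasPartials.mul (((D.smooth_m q hq).smooth_hasPartials.sub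
      (((D.smooth_b q hq).smooth_hasPartials.const_mul 2).mul
      hV.smooth_dx.smooth_hasPartials)).add (hf.mul (D.smooth_n q hq).smooth_hasPartials))
    have e := (L.unique R ((D.near hq).mono fun r hr => D.eq1 r hr)).2.2
    rw [D.dv_f q hq, D.dv_m q hq, D.dv_b q hq, D.dv_n q hq, hV.dv_dx, hV.smooth_dv.dv_dx,
      (partials_eq_zero ((D.near hq).mono hvv)).2.1, hvv q hq] at e
    linear_combination -(dx (dv V) q) * hbK q hq + e / 2
  have hn : ∀ q ∈ S, n q = 0 := by
    intro q hq
    have L := (D.smooth_b q hq).smooth_hasPartials.mul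
      (D.smooth_V q hq).smooth_dv.smooth_hasPartials
    have e := (L.unique (HasPartials.const 1 q) ((D.near hq).mono hbK)).2.1
    rw [hxv q hq, D.dx_b q hq] at e
    linear_combination -n q * hbK q hq - e / 2
  have hx : ∀ q ∈ S, dx V q = dv V q * m q / 2 := by
    intro q hq
    have h1 := D.eq1 q hq
    rw [hxv q hq, hn q hq] at h1
    linear_combination -dx V q * hbK q hq + h1 / 2
  have ht : ∀ q ∈ S, dt V q = dv V q * (m q ^ 2 / 4 - f q * dx m q / 2) := by
    intro q hq
    have hV := D.smooth_V q hq
    have e := (hV.smooth_dx.smooth_hasPartials.unique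
      ((hV.smooth_dv.smooth_hasPartials.mul (D.smooth_m q hq).smooth_hasPartials).const_mul (1 / 2))
      ((D.near hq).mono fun r hr => by rw [hx r hr]; ring)).2.1
    have h0 := D.eq0 q hq
    rw [hn q hq, e, hxv q hq, hx q hq] at h0
    linear_combination h0 - m q ^ 2 * dv V q / 4 * hbK q hq
  refine ⟨?_, hn q hq, hx q hq, ht q hq⟩
  have hV := D.smooth_V q hq
  have e := (hV.smooth_dt.smooth_hasPartials.unique
    (hV.smooth_dv.smooth_hasPartials.mul
      (((D.smooth_m q hq).smooth_hasPartials.sq.const_mul (1 / 4)).sub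
        (((D.smooth_f q hq).smooth_hasPartials.mul
          (D.smooth_m q hq).smooth_dx.smooth_hasPartials).const_mul (1 / 2))))
    ((D.near hq).mono fun r hr => by rw [ht r hr]; ring)).2.2
  rw [hvv q hq, D.dv_m q hq, D.dv_f q hq,
    (dv_partials_eq_zero (D.smooth_m q hq) ((D.near hq).mono D.dv_m)).2, hV.dv_dt] at e
  have h := hV.smooth_dv.smooth_hasPartials
  rw [hvv q hq, hxv q hq] at h
  exact h.cast (by linear_combination e) rfl rfl

end DeterminingSystem

/-! ### Quadratic coefficients -/

theorem hasDerivAt_quadratic (A B C y : ℝ) :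
    HasDerivAt (fun y => A * y ^ 2 + B * y + C) (2 * A * y + B) y := by
  have := (((hasDerivAt_pow 2 y).const_mul A).add ((hasDerivAt_id y).const_mul B)).add_const C
  exact this.congr_deriv (by simp; ring)

theorem deriv_quadratic (A B C : ℝ) :
    deriv (fun y => A * y ^ 2 + B * y + C) = fun y => 2 * A * y + B :=
  funext fun y => (hasDerivAt_quadratic A B C y).deriv

theorem iteratedDeriv_two_quadratic (A B C : ℝ) :
    iteratedDeriv 2 (fun y => A * y ^ 2 + B * y + C) = fun _ => 2 * A := by
  rw [iteratedDeriv_succ, iteratedDeriv_one, deriv_quadratic]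
  funext y
  simp

theorem iteratedDeriv_three_quadratic (A B C : ℝ) :
    iteratedDeriv 3 (fun y => A * y ^ 2 + B * y + C) = fun _ => 0 := by
  rw [iteratedDeriv_succ, iteratedDeriv_two_quadratic]
  simp

/-- A smooth function on an open interval with vanishing third derivative is a quadratic
polynomial. -/
theorem exists_quadratic {g : ℝ → ℝ} {I : Set ℝ} (hI : IsOpen I) (hc : I.OrdConnected)
    (hg : ContDiffOn ℝ ∞ g I) (h3 : ∀ y ∈ I, iteratedDeriv 3 g y = 0) :
    ∃ A B C, ∀ y ∈ I, g y = A * y ^ 2 + B * y + C := by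
  have hp := hc.isPreconnected
  have step : ∀ {u : ℝ → ℝ}, (∀ y ∈ I, HasDerivAt u 0 y) → ∃ k, ∀ y ∈ I, u y = k := by
    intro u hu
    exact hI.exists_is_const_of_deriv_eq_zero hp
      (fun y hy => (hu y hy).differentiableAt.differentiableWithinAt) fun y hy => (hu y hy).deriv
  have g1 : ContDiffOn ℝ ∞ (deriv g) I := ((contDiffOn_infty_iff_deriv_of_isOpen hI).1 hg).2
  have g2 : ContDiffOn ℝ ∞ (deriv (deriv g)) I :=
    ((contDiffOn_infty_iff_deriv_of_isOpen hI).1 g1).2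
  have D : ∀ {u : ℝ → ℝ}, ContDiffOn ℝ ∞ u I → ∀ y ∈ I, HasDerivAt u (deriv u y) y :=
    fun hu y hy => ((hu.contDiffAt (hI.mem_nhds hy)).differentiableAt (by simp)).hasDerivAt
  obtain ⟨A, hA⟩ := step (u := deriv (deriv g)) fun y hy => by
    have := D g2 y hy
    have h0 := h3 y hy
    rw [iteratedDeriv_succ, iteratedDeriv_succ, iteratedDeriv_one] at h0
    rwa [h0] at this
  obtain ⟨B, hB⟩ := step (u := fun y => deriv g y - A * y) fun y hy => by
    have := (D g1 y hy).sub ((hasDerivAt_id y).const_mul A)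
    rw [hA y hy, mul_one, sub_self] at this
    exact this
  obtain ⟨C, hC⟩ := step (u := fun y => g y - (A / 2 * y ^ 2 + B * y + 0)) fun y hy => by
    have := (D hg y hy).sub (hasDerivAt_quadratic (A / 2) B 0 y)
    exact this.congr_deriv (by linear_combination hB y hy)
  exact ⟨A / 2, B, C, fun y hy => by linear_combination hC y hy⟩

namespace PotBurgers

variable {E : PotBurgers} {t x : ℝ}

theorem isOpen_slice (E : PotBurgers) (t : ℝ) : IsOpen {x : ℝ | (t, x) ∈ E.dom} :=
  E.isOpen_dom.preimage (by fun_prop)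

theorem mem_times {z : ℝ × ℝ} (hz : z ∈ E.dom) : z.1 ∈ E.times := ⟨z, hz, rfl⟩

theorem somePt_mem (ht : t ∈ E.times) : (t, E.somePt t) ∈ E.dom := by
  obtain ⟨z, hz, rfl⟩ := ht
  exact Classical.epsilon_spec (p := fun x => (z.1, x) ∈ E.dom) ⟨z.2, hz⟩

theorem isOpen_times (E : PotBurgers) : IsOpen E.times := isOpenMap_fst _ E.isOpen_dom

theorem ordConnected_times (E : PotBurgers) : E.times.OrdConnected :=
  (E.isConnected_dom.image _ continuous_fst.continuousOn).isPreconnected.ordConnected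

/-- On each slice `t = const`, the coefficient `f` and its derivatives are given by a quadratic
polynomial with the coefficients `f2`, `f1`, `f0`. -/
theorem f_eq_near (hE : E ∈ quadClass) (h : (t, x) ∈ E.dom) :
    (fun y => E.f (t, y)) =ᶠ[𝓝 x] fun y => E.f2 t * y ^ 2 + E.f1 t * y + E.f0 t := by
  obtain ⟨A, B, C, hq⟩ := exists_quadratic (g := fun y => E.f (t, y)) (E.isOpen_slice t)
    (E.ordConnected_slice t)
    (fun y hy => ((E.contDiffAt_f hy).comp y
      (by fun_prop : ContDiffAt ℝ ∞ (fun y : ℝ => (t, y)) y)).contDiffWithinAt)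
    (fun y hy => hE.1 (t, y) hy)
  have near : ∀ y, (t, y) ∈ E.dom →
      (fun y => E.f (t, y)) =ᶠ[𝓝 y] fun y => A * y ^ 2 + B * y + C := fun y hy =>
    Filter.mem_of_superset ((E.isOpen_slice t).mem_nhds hy) hq
  have hp := somePt_mem (mem_times h)
  have hx : E.fx t = 2 * A * E.somePt t + B := by
    unfold fx
    rw [(near _ hp).deriv_eq, deriv_quadratic]
  have hxx : E.fxx t = 2 * A := by
    unfold fxx
    rw [(near _ hp).iteratedDeriv_eq, iteratedDeriv_two_quadratic]
  have hA : E.f2 t = A := by unfold f2; rw [hxx]; ring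
  have hB : E.f1 t = B := by unfold f1; rw [hx, hxx]; ring
  have hC : E.f0 t = C := by unfold f0; rw [hq _ hp, hx, hxx]; ring
  rw [hA, hB, hC]
  exact near x h

theorem f_eq (hE : E ∈ quadClass) {z : ℝ × ℝ} (h : z ∈ E.dom) :
    E.f z = E.f2 z.1 * z.2 ^ 2 + E.f1 z.1 * z.2 + E.f0 z.1 :=
  (f_eq_near hE (t := z.1) (x := z.2) h).self_of_nhds

theorem smooth_comp_base {q : ℝ × ℝ × ℝ} (h : base q ∈ E.dom) :
    ContDiffAt ℝ ∞ (fun r => E.f (base r)) q :=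
  (E.contDiffAt_f h).comp_base

theorem dx_f (hE : E ∈ quadClass) {q : ℝ × ℝ × ℝ} (h : base q ∈ E.dom) :
    dx (fun r => E.f (base r)) q = 2 * E.f2 q.1 * q.2.1 + E.f1 q.1 := by
  rw [← deriv_snd_eq_dx (E.contDiffAt_f h), (f_eq_near hE h).deriv_eq, deriv_quadratic]

theorem dx_dx_f (hE : E ∈ quadClass) {q : ℝ × ℝ × ℝ} (h : base q ∈ E.dom) :
    dx (dx (fun r => E.f (base r))) q = 2 * E.f2 q.1 := by
  rw [← iteratedDeriv_two_eq_dx_dx (E.contDiffAt_f h), (f_eq_near hE h).iteratedDeriv_eq,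
    iteratedDeriv_two_quadratic]

theorem smooth_coefficients (hE : E ∈ quadClass) (ht : t ∈ E.times) :
    ContDiffAt ℝ ∞ E.f2 t ∧ ContDiffAt ℝ ∞ E.f1 t ∧ ContDiffAt ℝ ∞ E.f0 t := by
  obtain ⟨⟨t, x⟩, hz, rfl⟩ := ht
  simp only
  have hγ : ContDiff ℝ ∞ (fun s : ℝ => (s, x, (0 : ℝ))) := by fun_prop
  have near : ∀ᶠ s in 𝓝 t, base (s, x, 0) ∈ E.dom :=
    (E.isOpen_dom.preimage (continuous_base.comp hγ.continuous)).mem_nhds hz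
  have s0 := smooth_comp_base (E := E) (q := (t, x, 0)) hz
  have c2 : ContDiffAt ℝ ∞ E.f2 t := by
    have : ContDiffAt ℝ ∞ (fun s => dx (dx (fun r => E.f (base r))) (s, x, 0) / 2) t :=
      (s0.smooth_dx.smooth_dx.comp t hγ.contDiffAt).div_const 2
    refine this.congr_of_eventuallyEq (near.mono fun s hs => ?_)
    have := dx_dx_f hE hs
    simp only at this ⊢
    rw [this]
    ring
  have c1 : ContDiffAt ℝ ∞ E.f1 t := by
    have : ContDiffAt ℝ ∞ (fun s => dx (fun r => E.f (base r)) (s, x, 0) - 2 * E.f2 s * x) t :=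
      (s0.smooth_dx.comp t hγ.contDiffAt).sub ((contDiffAt_const.mul c2).mul contDiffAt_const)
    refine this.congr_of_eventuallyEq (near.mono fun s hs => ?_)
    have := dx_f hE hs
    simp only at this ⊢
    rw [this]
    ring
  refine ⟨c2, c1, ?_⟩
  have : ContDiffAt ℝ ∞ (fun s => E.f (base (s, x, 0)) - (E.f2 s * x ^ 2 + E.f1 s * x)) t :=
    (s0.comp t hγ.contDiffAt).sub ((c2.mul contDiffAt_const).add (c1.mul contDiffAt_const))
  refine this.congr_of_eventuallyEq (near.mono fun s hs => ?_)
  have := f_eq hE hs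
  simp only [base] at this ⊢
  rw [this]
  ring

theorem smooth_f2 (hE : E ∈ quadClass) : ContDiffOn ℝ ∞ E.f2 E.times :=
  fun _ ht => (smooth_coefficients hE ht).1.contDiffWithinAt

theorem smooth_f1 (hE : E ∈ quadClass) : ContDiffOn ℝ ∞ E.f1 E.times :=
  fun _ ht => (smooth_coefficients hE ht).2.1.contDiffWithinAt

theorem smooth_f0 (hE : E ∈ quadClass) : ContDiffOn ℝ ∞ E.f0 E.times :=
  fun _ ht => (smooth_coefficients hE ht).2.2.contDiffWithinAt

/-- The coefficient of an equation of the subclass is nowhere locally constant. -/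
theorem not_eventually_partials_zero (hE : E ∈ quadClass) {q : ℝ × ℝ × ℝ}
    (h : base q ∈ E.dom) :
    ¬ ∀ᶠ r in 𝓝 q, dt (fun r => E.f (base r)) r = 0 ∧ dx (fun r => E.f (base r)) r = 0 := by
  intro h0
  have hd : ∀ᶠ r in 𝓝 q, base r ∈ E.dom :=
    (E.isOpen_dom.preimage continuous_base).mem_nhds h
  obtain ⟨ε, hε, hball⟩ := Metric.eventually_nhds_iff_ball.1 (h0.and hd)
  obtain ⟨k, hk⟩ := exists_const_of_hasPartials_zero (g := fun r => E.f (base r))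
    (S := Metric.ball q ε) Metric.isOpen_ball (convex_ball q ε).isPreconnected (fun r hr => by
      obtain ⟨⟨h1, h2⟩, h3⟩ := hball r hr
      exact (smooth_comp_base h3).smooth_hasPartials.cast h1 h2
        (dv_comp_base E.f (E.contDiffAt_f h3)))
  refine hE.2 (base '' Metric.ball q ε) (isOpenMap_base _ Metric.isOpen_ball)
    ⟨base q, q, Metric.mem_ball_self hε, rfl⟩ ?_ ⟨k, ?_⟩
  · rintro _ ⟨r, hr, rfl⟩
    exact (hball r hr).2
  · rintro _ ⟨r, hr, rfl⟩
    exact hk r hr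

end PotBurgers

/-! ### Antiderivatives and the explicit formulas -/

namespace AntiderivativeChoice

variable (P : AntiderivativeChoice) {c : Constants} {E : PotBurgers} {J : Set ℝ} {t : ℝ}

theorem smooth_int {g : ℝ → ℝ} (hJ : IsOpen J) (hc : J.OrdConnected) (hg : ContDiffOn ℝ ∞ g J) :
    ContDiffOn ℝ ∞ (P.int J g) J := by
  have h := P.hasDerivAt_int J g hJ hc hg.continuousOn
  refine (contDiffOn_infty_iff_deriv_of_isOpen hJ).2
    ⟨fun t ht => (h t ht).differentiableAt.differentiableWithinAt, ?_⟩
  exact hg.congr fun t ht => (h t ht).deriv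

theorem lam_pos (t : ℝ) : 0 < P.lam E t := Real.exp_pos _

theorem lam_ne (t : ℝ) : P.lam E t ≠ 0 := (P.lam_pos t).ne'

theorem smooth_lam (hE : E ∈ quadClass) : ContDiffOn ℝ ∞ (P.lam E) E.times :=
  Real.contDiff_exp.comp_contDiffOn (contDiffOn_const.mul
    (P.smooth_int E.isOpen_times E.ordConnected_times (E.smooth_f2 hE)))

theorem hasDerivAt_lam (hE : E ∈ quadClass) (ht : t ∈ E.times) :
    HasDerivAt (P.lam E) (2 * E.f2 t * P.lam E t) t := by
  have := ((P.hasDerivAt_int E.times E.f2 E.isOpen_times E.ordConnected_times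
    (E.smooth_f2 hE).continuousOn t ht).const_mul 2).exp
  refine this.congr_deriv ?_
  unfold lam
  ring

theorem smooth_inv_lam (hE : E ∈ quadClass) :
    ContDiffOn ℝ ∞ (fun s => 1 / P.lam E s) E.times :=
  contDiffOn_const.div (P.smooth_lam hE) fun t _ => P.lam_ne t

theorem smooth_f1_div_lam (hE : E ∈ quadClass) :
    ContDiffOn ℝ ∞ (fun s => E.f1 s / P.lam E s) E.times :=
  (E.smooth_f1 hE).div (P.smooth_lam hE) fun t _ => P.lam_ne t

theorem hasDerivAt_int_inv_lam (hE : E ∈ quadClass) (ht : t ∈ E.times) :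
    HasDerivAt (P.int E.times fun s => 1 / P.lam E s) (1 / P.lam E t) t :=
  P.hasDerivAt_int _ _ E.isOpen_times E.ordConnected_times (P.smooth_inv_lam hE).continuousOn t ht

theorem hasDerivAt_int_f1_div_lam (hE : E ∈ quadClass) (ht : t ∈ E.times) :
    HasDerivAt (P.int E.times fun s => E.f1 s / P.lam E s) (E.f1 t / P.lam E t) t :=
  P.hasDerivAt_int _ _ E.isOpen_times E.ordConnected_times
    (P.smooth_f1_div_lam hE).continuousOn t ht

theorem smooth_den (hE : E ∈ quadClass) : ContDiffOn ℝ ∞ (P.den c E) E.times :=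
  (contDiffOn_const.mul (P.smooth_int E.isOpen_times E.ordConnected_times
    (P.smooth_inv_lam hE))).add contDiffOn_const

theorem smooth_Y (hE : E ∈ quadClass) : ContDiffOn ℝ ∞ (P.Y c E) E.times :=
  (contDiffOn_const.mul (P.smooth_int E.isOpen_times E.ordConnected_times
    (P.smooth_f1_div_lam hE))).add contDiffOn_const

theorem hasDerivAt_den (hE : E ∈ quadClass) (ht : t ∈ E.times) :
    HasDerivAt (P.den c E) (c.c1 / P.lam E t) t := by
  have := ((P.hasDerivAt_int_inv_lam hE ht).const_mul c.c1).add_const c.c2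
  exact this.congr_deriv (by ring)

theorem hasDerivAt_Y (hE : E ∈ quadClass) (ht : t ∈ E.times) :
    HasDerivAt (P.Y c E) (c.c1 * E.f1 t / P.lam E t) t := by
  have := ((P.hasDerivAt_int_f1_div_lam hE ht).const_mul c.c1).add_const c.c3
  exact this.congr_deriv (by ring)

theorem hasDerivAt_X1 (hE : E ∈ quadClass) (ht : t ∈ E.times) (h0 : P.den c E t ≠ 0) :
    HasDerivAt (P.X1 c E) (-(c.c1 * P.X1 c E t ^ 2 / P.lam E t)) t := by
  have := (P.hasDerivAt_den (c := c) hE ht).inv h0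
  refine this.congr_deriv ?_
  unfold X1
  field_simp

theorem X1_ne (h0 : P.den c E t ≠ 0) : P.X1 c E t ≠ 0 := inv_ne_zero h0

end AntiderivativeChoice

/-- An open interval of values of `t` on which the formulas with the constants `c` are defined for
the equation `E`. -/
structure IsRegularInterval (P : AntiderivativeChoice) (c : Constants) (E : PotBurgers)
    (J : Set ℝ) : Prop where
  isOpen : IsOpen J
  ordConnected : J.OrdConnected
  subset_times : J ⊆ E.times
  den_ne : ∀ t ∈ J, P.den c E t ≠ 0

namespace IsRegularInterval

open AntiderivativeChoice

variable {P : AntiderivativeChoice} {c : Constants} {E : PotBurgers} {J : Set ℝ} {t : ℝ}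

theorem smooth_X1 (R : IsRegularInterval P c E J) (hE : E ∈ quadClass) :
    ContDiffOn ℝ ∞ (P.X1 c E) J :=
  ((P.smooth_den hE).mono R.subset_times).inv R.den_ne

theorem smooth_X2 (R : IsRegularInterval P c E J) (hE : E ∈ quadClass) :
    ContDiffOn ℝ ∞ (P.X2 c E) J :=
  ((R.smooth_X1 hE).div_const 2).mul ((P.smooth_Y hE).mono R.subset_times)

theorem smooth_X1_sq (R : IsRegularInterval P c E J) (hE : E ∈ quadClass) :
    ContDiffOn ℝ ∞ (fun s => P.X1 c E s ^ 2) J :=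
  (R.smooth_X1 hE).pow 2

theorem smooth_X1_sq_mul_Y (R : IsRegularInterval P c E J) (hE : E ∈ quadClass) :
    ContDiffOn ℝ ∞ (fun s => P.X1 c E s ^ 2 * P.Y c E s) J :=
  (R.smooth_X1_sq hE).mul ((P.smooth_Y hE).mono R.subset_times)

theorem smooth_X2_sq (R : IsRegularInterval P c E J) (hE : E ∈ quadClass) :
    ContDiffOn ℝ ∞ (fun s => P.X2 c E s ^ 2) J :=
  (R.smooth_X2 hE).pow 2

theorem smooth_f0_term (R : IsRegularInterval P c E J) (hE : E ∈ quadClass) :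
    ContDiffOn ℝ ∞ (fun s => E.f0 s / P.lam E s * P.X1 c E s) J :=
  (((E.smooth_f0 hE).mono R.subset_times).div ((P.smooth_lam hE).mono R.subset_times)
    fun t _ => P.lam_ne t).mul (R.smooth_X1 hE)

theorem hasDerivAt_int (R : IsRegularInterval P c E J) {g : ℝ → ℝ} (hg : ContDiffOn ℝ ∞ g J)
    (ht : t ∈ J) : HasDerivAt (P.int J g) (g t) t :=
  P.hasDerivAt_int J g R.isOpen R.ordConnected hg.continuousOn t ht

theorem hasDerivAt_tNew (R : IsRegularInterval P c E J) (hE : E ∈ quadClass) (ht : t ∈ J) :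
    HasDerivAt (P.tNew c E J) (P.X1 c E t ^ 2 / c.c0) t := by
  have := ((R.hasDerivAt_int (R.smooth_X1_sq hE) ht).const_mul (1 / c.c0)).add_const c.c5
  exact this.congr_deriv (by ring)

theorem hasPartials_xNew (R : IsRegularInterval P c E J) (hE : E ∈ quadClass)
    {q : ℝ × ℝ × ℝ} (hq : q.1 ∈ J) :
    HasPartials (fun r => P.xNew c E J r.1 r.2.1)
      (P.X1 c E q.1 * (-(c.c1 * P.X1 c E q.1 / P.lam E q.1) * q.2.1
        + P.X1 c E q.1 * P.Y c E q.1)) (P.X1 c E q.1) 0 q := by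
  have h1 := HasPartials.of_time (q := q)
    (P.hasDerivAt_X1 hE (R.subset_times hq) (R.den_ne _ hq))
  have h2 := HasPartials.of_time (q := q) (R.hasDerivAt_int (R.smooth_X1_sq_mul_Y hE) hq)
  exact (((h1.mul (HasPartials.snd_fst q)).add h2).add (HasPartials.const c.c4 q)).cast
    (by ring) (by ring) (by ring)

theorem hasPartials_vNew (R : IsRegularInterval P c E J) (hE : E ∈ quadClass)
    {q : ℝ × ℝ × ℝ} (hq : q.1 ∈ J) (hd : base q ∈ E.dom) :
    HasPartials (fun r => P.vNew c E J r.1 r.2.1 r.2.2)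
      (c.c0 * ((-(c.c1 * P.X1 c E q.1 / P.lam E q.1) * q.2.1 + P.X1 c E q.1 * P.Y c E q.1) ^ 2 / 4
        + E.f (base q) * (c.c1 * P.X1 c E q.1 / P.lam E q.1) / 2))
      (c.c0 * (-(c.c1 * P.X1 c E q.1 / P.lam E q.1) * q.2.1 + P.X1 c E q.1 * P.Y c E q.1) / 2)
      c.c0 q := by
  have ht := R.subset_times hq
  have h0 := R.den_ne _ hq
  have hl := P.lam_ne (E := E) q.1
  have h1 := HasPartials.of_time (q := q) (P.hasDerivAt_X1 hE ht h0)
  have h2 := HasPartials.of_time (q := q) (P.hasDerivAt_lam hE ht)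
  have h3 := HasPartials.of_time (q := q) (P.hasDerivAt_Y (c := c) hE ht)
  have h4 := HasPartials.of_time (q := q) (R.hasDerivAt_int (R.smooth_X2_sq hE) hq)
  have h5 := HasPartials.of_time (q := q) (R.hasDerivAt_int (R.smooth_f0_term hE) hq)
  have hX2 := (h1.const_mul (1 / 2)).mul h3
  have hx := HasPartials.snd_fst q
  have := (((((HasPartials.snd_snd q).sub (((h1.const_mul c.c1).div (h2.const_mul 4)
    (by simpa using hl)).mul hx.sq)).add (hX2.mul hx)).add h4).add
      (h5.const_mul (c.c1 / 2))).const_mul c.c0 |>.add (HasPartials.const c.c6 q)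
  have hf := E.f_eq hE hd
  simp only [base] at hf ⊢
  rw [hf]
  have h6 := this.congr (h := fun r => P.vNew c E J r.1 r.2.1 r.2.2)
    (Eventually.of_forall fun r => by simp only [vNew, X2]; ring)
  refine h6.cast ?_ ?_ ?_
  · simp only [X2]
    field_simp
    ring
  · field_simp
    ring
  · ring

end IsRegularInterval

/-! ### Admissible transformations have the stated form -/

section Necessity

open DeterminingSystem

variable {E E' : PotBurgers} {φ : LocalMap}

theorem IsAdmissible.smooth_div (h : IsAdmissible E φ E') {g : ℝ × ℝ × ℝ → ℝ}
    {q : ℝ × ℝ × ℝ} (hq : q ∈ φ.source) (hg : ContDiffAt ℝ ∞ g q) :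
    ContDiffAt ℝ ∞ (fun r => g r / dx (xComp φ) r) q :=
  hg.div (h.1.smooth_xComp hq).smooth_dx (h.xComp_fiber hq).2.1

theorem IsAdmissible.determiningSystem (h : IsAdmissible E φ E') :
    DeterminingSystem φ.source (fun r => E.f (base r))
      (fun r => dt (tComp φ) r / dx (xComp φ) r ^ 2)
      (fun r => dt (xComp φ) r / dx (xComp φ) r)
      (fun r => dx (dx (xComp φ)) r / dx (xComp φ) r) (vComp φ) := by
  have near : ∀ {q}, q ∈ φ.source → ∀ᶠ r in 𝓝 q, r ∈ φ.source := fun hq =>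
    φ.open_source.mem_nhds hq
  have hXx : ∀ q ∈ φ.source, dx (xComp φ) q ≠ 0 := fun q hq => (h.xComp_fiber hq).2.1
  have hXv : ∀ q ∈ φ.source, dv (xComp φ) q = 0 := fun q hq => (h.xComp_fiber hq).1
  have hTv : ∀ q ∈ φ.source, dv (tComp φ) q = 0 := fun q hq => (h.tComp_time hq).2
  have hTx : ∀ q ∈ φ.source, dx (tComp φ) q = 0 := fun q hq => (h.tComp_time hq).1
  have pX : ∀ q ∈ φ.source, HasPartials (dx (xComp φ)) (dt (dx (xComp φ)) q)
      (dx (dx (xComp φ)) q) 0 q := by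
    intro q hq
    have sX := h.1.smooth_xComp hq
    exact sX.smooth_dx.smooth_hasPartials.cast rfl rfl
      (dv_partials_eq_zero sX ((near hq).mono hXv)).2
  have pT : ∀ q ∈ φ.source, HasPartials (dt (tComp φ)) (dt (dt (tComp φ)) q) 0 0 q := by
    intro q hq
    have sT := h.1.smooth_tComp hq
    refine sT.smooth_dt.smooth_hasPartials.cast rfl ?_
      (dv_partials_eq_zero sT ((near hq).mono hTv)).1
    rw [← sT.dt_dx]
    exact (partials_eq_zero ((near hq).mono hTx)).1
  have pb : ∀ q ∈ φ.source, HasPartials (fun r => dt (tComp φ) r / dx (xComp φ) r ^ 2) _ _ _ q :=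
    fun q hq => (pT q hq).div (pX q hq).sq (pow_ne_zero 2 (hXx q hq))
  have sb : ∀ q ∈ φ.source, ContDiffAt ℝ ∞ (fun r => dt (tComp φ) r / dx (xComp φ) r ^ 2) q :=
    fun q hq => (h.1.smooth_tComp hq).smooth_dt.div ((h.1.smooth_xComp hq).smooth_dx.pow 2)
      (pow_ne_zero 2 (hXx q hq))
  refine
    { isOpen := φ.open_source
      smooth_f := fun q hq => E.smooth_comp_base (h.1.source_subset q hq)
      smooth_b := sb
      smooth_m := fun q hq => h.smooth_div hq (h.1.smooth_xComp hq).smooth_dt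
      smooth_n := fun q hq => h.smooth_div hq (h.1.smooth_xComp hq).smooth_dx.smooth_dx
      smooth_V := fun q hq => h.1.smooth_vComp hq
      dv_f := fun q hq => dv_comp_base _ (E.contDiffAt_f (h.1.source_subset q hq))
      dv_b := fun q hq => (pb q hq).dv_eq.trans (by ring)
      dv_m := fun q hq => ?_
      dv_n := fun q hq => ?_
      dx_b := fun q hq => (pb q hq).dx_eq.trans ?_
      f_ne := fun q hq => h.f_ne_zero hq
      b_ne := fun q hq => div_ne_zero (h.dt_tComp_ne_zero hq) (pow_ne_zero 2 (hXx q hq))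
      dv_V_ne := fun q hq => (h.xComp_fiber hq).2.2.1
      eq0 := fun q hq => (h.determining_eqs hq).1
      eq1 := fun q hq => (h.determining_eqs hq).2.1
      eq2 := fun q hq => (h.determining_eqs hq).2.2 }
  · have sX := h.1.smooth_xComp hq
    refine (sX.smooth_dt.smooth_hasPartials.div (pX q hq) (hXx q hq)).dv_eq.trans ?_
    rw [(dv_partials_eq_zero sX ((near hq).mono hXv)).1]
    ring
  · have sX := h.1.smooth_xComp hq
    refine (sX.smooth_dx.smooth_dx.smooth_hasPartials.div (pX q hq) (hXx q hq)).dv_eq.trans ?_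
    rw [(dv_partials_eq_zero sX.smooth_dx ((near hq).mono fun r hr => (pX r hr).dv_eq)).2]
    ring
  · have := hXx q hq
    field_simp
    ring

/-- `X_t / X_x`. -/
noncomputable def drift (φ : LocalMap) (r : ℝ × ℝ × ℝ) : ℝ := dt (xComp φ) r / dx (xComp φ) r

/-- The first derivatives of an admissible transformation of an equation of the subclass, together
with the equations satisfied by the drift `m = X_t / X_x` and its slope `m_x`. -/
theorem IsAdmissible.first_derivatives (hE : E ∈ quadClass) (h : IsAdmissible E φ E')
    {q : ℝ × ℝ × ℝ} (hq : q ∈ φ.source) :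
    HasPartials (dv (vComp φ)) 0 0 0 q ∧
    dv (vComp φ) q * dt (tComp φ) q = dx (xComp φ) q ^ 2 ∧
    HasPartials (dx (xComp φ)) (dx (drift φ) q * dx (xComp φ) q) 0 0 q ∧
    HasPartials (vComp φ)
      (dv (vComp φ) q * (drift φ q ^ 2 / 4 - E.f (base q) * dx (drift φ) q / 2))
      (dv (vComp φ) q * drift φ q / 2) (dv (vComp φ) q) q ∧
    HasPartials (drift φ) ((drift φ q - (2 * E.f2 q.1 * q.2.1 + E.f1 q.1)) * dx (drift φ) q)
      (dx (drift φ) q) 0 q ∧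
    HasPartials (dx (drift φ)) (dx (drift φ) q ^ 2 - 2 * E.f2 q.1 * dx (drift φ) q) 0 0 q := by
  have D := h.determiningSystem
  have hnc : ∀ q ∈ φ.source, ¬ ∀ᶠ r in 𝓝 q, dt (fun r => E.f (base r)) r = 0 ∧
      dx (fun r => E.f (base r)) r = 0 := fun q hq =>
    E.not_eventually_partials_zero hE (h.1.source_subset q hq)
  have near : ∀ {q}, q ∈ φ.source → ∀ᶠ r in 𝓝 q, r ∈ φ.source := fun hq =>
    φ.open_source.mem_nhds hq
  have hXx : ∀ q ∈ φ.source, dx (xComp φ) q ≠ 0 := fun q hq => (h.xComp_fiber hq).2.1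
  have hXv : ∀ q ∈ φ.source, dv (xComp φ) q = 0 := fun q hq => (h.xComp_fiber hq).1
  have hXxx : ∀ q ∈ φ.source, dx (dx (xComp φ)) q = 0 := fun q hq =>
    (div_eq_zero_iff.1 (D.solution hnc hq).2.1).resolve_right (hXx q hq)
  have sm : ∀ q ∈ φ.source, ContDiffAt ℝ ∞ (drift φ) q := D.smooth_m
  have hmv : ∀ q ∈ φ.source, dv (drift φ) q = 0 := D.dv_m
  have hslope : ∀ q ∈ φ.source, dt (dx (xComp φ)) q = dx (drift φ) q * dx (xComp φ) q := by
    intro q hq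
    have sX := h.1.smooth_xComp hq
    have e := (((sm q hq).smooth_hasPartials.mul sX.smooth_dx.smooth_hasPartials).unique
      sX.smooth_dt.smooth_hasPartials ((near hq).mono fun r hr => by
        have := hXx r hr
        simp only [drift]
        field_simp)).2.1
    rw [hXxx q hq] at e
    rw [sX.dt_dx]
    linear_combination -e
  have pX : ∀ q ∈ φ.source, HasPartials (dx (xComp φ)) (dx (drift φ) q * dx (xComp φ) q) 0 0 q := by
    intro q hq
    have sX := h.1.smooth_xComp hq
    exact sX.smooth_dx.smooth_hasPartials.cast (hslope q hq) (hXxx q hq)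
      (dv_partials_eq_zero sX ((near hq).mono hXv)).2
  have hhx : ∀ q ∈ φ.source, dx (dx (drift φ)) q = 0 := by
    intro q hq
    have sX := h.1.smooth_xComp hq
    have e := (((sm q hq).smooth_dx.smooth_hasPartials.mul (pX q hq)).unique
      sX.smooth_dx.smooth_dt.smooth_hasPartials ((near hq).mono fun r hr =>
        (hslope r hr).symm)).2.1
    rw [← sX.smooth_dx.dt_dx, (partials_eq_zero ((near hq).mono hXxx)).1] at e
    refine (mul_eq_zero.1 ?_).resolve_right (hXx q hq)
    linear_combination e
  have pV : ∀ q ∈ φ.source, HasPartials (vComp φ)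
      (dv (vComp φ) q * (drift φ q ^ 2 / 4 - E.f (base q) * dx (drift φ) q / 2))
      (dv (vComp φ) q * drift φ q / 2) (dv (vComp φ) q) q := by
    intro q hq
    obtain ⟨-, -, h1, h2⟩ := D.solution hnc hq
    exact (h.1.smooth_vComp hq).smooth_hasPartials.cast h2 h1 rfl
  have hmt : ∀ q ∈ φ.source, dt (drift φ) q =
      (drift φ q - dx (fun r => E.f (base r)) q) * dx (drift φ) q := by
    intro q hq
    have sV := h.1.smooth_vComp hq
    have pm := (sm q hq).smooth_hasPartials
    have pK := (D.solution hnc hq).1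
    have e1 := (sV.smooth_dx.smooth_hasPartials.unique ((pK.mul pm).const_mul (1 / 2))
      ((near hq).mono fun r hr => by rw [(pV r hr).dx_eq]; ring)).1
    have e2 := (sV.smooth_dt.smooth_hasPartials.unique (pK.mul ((pm.sq.const_mul (1 / 4)).sub
      (((D.smooth_f q hq).smooth_hasPartials.mul (sm q hq).smooth_dx.smooth_hasPartials).const_mul
        (1 / 2)))) ((near hq).mono fun r hr => by rw [(pV r hr).dt_eq]; ring)).2.1
    rw [hhx q hq] at e2
    rw [sV.dt_dx] at e1
    refine mul_left_cancel₀ (D.dv_V_ne q hq) ?_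
    linear_combination 2 * e2 - 2 * e1
  have pm : ∀ q ∈ φ.source, HasPartials (drift φ)
      ((drift φ q - (2 * E.f2 q.1 * q.2.1 + E.f1 q.1)) * dx (drift φ) q) (dx (drift φ) q) 0 q := by
    intro q hq
    refine (sm q hq).smooth_hasPartials.cast ?_ rfl (hmv q hq)
    rw [hmt q hq, E.dx_f hE (h.1.source_subset q hq)]
  refine ⟨(D.solution hnc hq).1, ?_, pX q hq, pV q hq, pm q hq, ?_⟩
  · have := D.b_mul_dv_V hnc hq
    have hx := hXx q hq
    field_simp at this
    linear_combination this
  · have e := ((sm q hq).smooth_dt.smooth_hasPartials.unique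
      (((sm q hq).smooth_hasPartials.sub
        (D.smooth_f q hq).smooth_dx.smooth_hasPartials).mul
        (sm q hq).smooth_dx.smooth_hasPartials) ((near hq).mono hmt)).2.1
    refine (sm q hq).smooth_dx.smooth_hasPartials.cast ?_ (hhx q hq)
      (dv_partials_eq_zero (sm q hq) ((near hq).mono hmv)).2
    rw [E.dx_dx_f hE (h.1.source_subset q hq), hhx q hq] at e
    rw [(sm q hq).dt_dx]
    linear_combination e

theorem IsPointTransformation.regularInterval_of_den_ne {P : AntiderivativeChoice}
    {c : Constants} (h : IsPointTransformation E φ E')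
    (hd : ∀ q ∈ φ.source, P.den c E q.1 ≠ 0) :
    IsRegularInterval P c E (Prod.fst '' φ.source) where
  isOpen := isOpenMap_fst _ φ.open_source
  ordConnected :=
    (h.isConnected_source.image _ continuous_fst.continuousOn).isPreconnected.ordConnected
  subset_times := by
    rintro _ ⟨q, hq, rfl⟩
    exact PotBurgers.mem_times (h.source_subset q hq)
  den_ne := by
    rintro _ ⟨q, hq, rfl⟩
    exact hd q hq

/-- Every admissible transformation of an equation of the subclass is given by the formulas. Each
constant is read off as a combination of the derivatives of the transformation all of whose partial
derivatives vanish. -/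
theorem IsAdmissible.exists_hasForm (P : AntiderivativeChoice) (hE : E ∈ quadClass)
    (h : IsAdmissible E φ E') : ∃ c, HasForm P c E φ E' := by
  have hS := φ.open_source
  have hc := h.1.isConnected_source.isPreconnected
  obtain ⟨q₀, hq₀⟩ := h.1.isConnected_source.nonempty
  have F := fun {q} (hq : q ∈ φ.source) => h.first_derivatives hE hq
  have hXx : ∀ q ∈ φ.source, dx (xComp φ) q ≠ 0 := fun q hq => (h.xComp_fiber hq).2.1
  have ht : ∀ q ∈ φ.source, q.1 ∈ E.times := fun q hq =>
    PotBurgers.mem_times (h.1.source_subset q hq)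
  obtain ⟨c0, hc0⟩ := exists_const_of_hasPartials_zero hS hc fun q hq => (F hq).1
  obtain ⟨c1, hc1⟩ := exists_const_of_hasPartials_zero
    (g := fun r => -(P.lam E r.1 * dx (drift φ) r / dx (xComp φ) r)) hS hc (by
      intro q hq
      obtain ⟨-, -, pX, -, -, ph⟩ := F hq
      have := hXx q hq
      exact ((((HasPartials.of_time (P.hasDerivAt_lam hE (ht q hq))).mul ph).div pX
        (hXx q hq)).neg).cast (by field_simp; ring) (by simp) (by simp))
  -- the slope of the drift in terms of `c₁`
  have hh : ∀ q ∈ φ.source, P.lam E q.1 * dx (drift φ) q = -(c1 * dx (xComp φ) q) := by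
    intro q hq
    have := hXx q hq
    rw [← hc1 q hq]
    field_simp
  obtain ⟨c2, hc2⟩ := exists_const_of_hasPartials_zero
    (g := fun r => (dx (xComp φ) r)⁻¹ - c1 * P.int E.times (fun s => 1 / P.lam E s) r.1) hS hc (by
      intro q hq
      obtain ⟨-, -, pX, -, -, -⟩ := F hq
      have hx := hXx q hq
      have hl := P.lam_ne (E := E) q.1
      refine ((pX.inv hx).sub ((HasPartials.of_time
        (P.hasDerivAt_int_inv_lam hE (ht q hq))).const_mul c1)).cast ?_ (by simp) (by simp)
      field_simp
      linear_combination -hh q hq)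
  obtain ⟨c3, hc3⟩ := exists_const_of_hasPartials_zero
    (g := fun r => (drift φ r - dx (drift φ) r * r.2.1) / dx (xComp φ) r
      - c1 * P.int E.times (fun s => E.f1 s / P.lam E s) r.1) hS hc (by
      intro q hq
      obtain ⟨-, -, pX, -, pm, ph⟩ := F hq
      have hx := hXx q hq
      have hl := P.lam_ne (E := E) q.1
      refine (((pm.sub (ph.mul (HasPartials.snd_fst q))).div pX hx).sub ((HasPartials.of_time
        (P.hasDerivAt_int_f1_div_lam hE (ht q hq))).const_mul c1)).cast ?_ ?_ ?_
      · field_simp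
        linear_combination -(E.f1 q.1) * hh q hq
      · simp
      · simp)
  have hc0' : c0 ≠ 0 := by rw [← hc0 q₀ hq₀]; exact (h.xComp_fiber hq₀).2.2.1
  have hden : ∀ q ∈ φ.source, c1 * P.int E.times (fun s => 1 / P.lam E s) q.1 + c2
      = (dx (xComp φ) q)⁻¹ := by
    intro q hq
    rw [← hc2 q hq]
    ring
  have hc12 : (c1, c2) ≠ (0, 0) := by
    intro h0
    obtain ⟨rfl, rfl⟩ := Prod.mk.inj h0
    exact inv_ne_zero (hXx q₀ hq₀) (by rw [← hden q₀ hq₀]; ring)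
  let c : ℝ → ℝ → ℝ → Constants := fun c4 c5 c6 => ⟨c0, c1, c2, c3, c4, c5, c6, hc0', hc12⟩
  set J := Prod.fst '' φ.source with hJ
  have hJm : ∀ q ∈ φ.source, q.1 ∈ J := fun q hq => mem_image_of_mem _ hq
  have R : IsRegularInterval P (c 0 0 0) E J := h.1.regularInterval_of_den_ne fun q hq => by
    change c1 * P.int E.times (fun s => 1 / P.lam E s) q.1 + c2 ≠ 0
    rw [hden q hq]
    exact inv_ne_zero (hXx q hq)
  have hX1 : ∀ q ∈ φ.source, P.X1 (c 0 0 0) E q.1 = dx (xComp φ) q := by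
    intro q hq
    change (c1 * P.int E.times (fun s => 1 / P.lam E s) q.1 + c2)⁻¹ = _
    rw [hden q hq, inv_inv]
  have hY : ∀ q ∈ φ.source, P.X1 (c 0 0 0) E q.1 * P.Y (c 0 0 0) E q.1 =
      drift φ q - dx (drift φ) q * q.2.1 := by
    intro q hq
    have hx := hXx q hq
    rw [hX1 q hq]
    change _ * (c1 * P.int E.times (fun s => E.f1 s / P.lam E s) q.1 + c3) = _
    rw [← hc3 q hq]
    field_simp
    ring
  have hslope : ∀ q ∈ φ.source, c1 * P.X1 (c 0 0 0) E q.1 / P.lam E q.1 = -dx (drift φ) q := by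
    intro q hq
    have hl := P.lam_ne (E := E) q.1
    rw [hX1 q hq]
    field_simp
    linear_combination hh q hq
  have hdrift : ∀ q ∈ φ.source, -(c1 * P.X1 (c 0 0 0) E q.1 / P.lam E q.1) * q.2.1
      + P.X1 (c 0 0 0) E q.1 * P.Y (c 0 0 0) E q.1 = drift φ q := by
    intro q hq
    rw [hslope q hq, hY q hq]
    ring
  obtain ⟨c4, hc4⟩ := exists_const_of_hasPartials_zero
    (g := fun r => xComp φ r - P.xNew (c 0 0 0) E J r.1 r.2.1) hS hc (by
      intro q hq
      have hx := hXx q hq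
      refine ((h.1.smooth_xComp hq).smooth_hasPartials.sub
        (R.hasPartials_xNew hE (hJm q hq))).cast ?_ ?_ ?_
      · rw [hdrift q hq, hX1 q hq]
        simp only [drift]
        field_simp
        ring
      · rw [hX1 q hq, sub_self]
      · rw [(h.xComp_fiber hq).1, sub_self])
  obtain ⟨c5, hc5⟩ := exists_const_of_hasPartials_zero
    (g := fun r => tComp φ r - P.tNew (c 0 0 0) E J r.1) hS hc (by
      intro q hq
      refine ((h.1.smooth_tComp hq).smooth_hasPartials.sub
        (HasPartials.of_time (R.hasDerivAt_tNew hE (hJm q hq)))).cast ?_ ?_ ?_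
      · rw [hX1 q hq, ← (F hq).2.1, hc0 q hq]
        change _ - c0 * _ / c0 = 0
        field_simp
        ring
      · rw [(h.tComp_time hq).1, sub_self]
      · rw [(h.tComp_time hq).2, sub_self])
  obtain ⟨c6, hc6⟩ := exists_const_of_hasPartials_zero
    (g := fun r => vComp φ r - P.vNew (c 0 0 0) E J r.1 r.2.1 r.2.2) hS hc (by
      intro q hq
      have e1 := hdrift q hq
      have e2 := hslope q hq
      refine ((F hq).2.2.2.1.sub
        (R.hasPartials_vNew hE (hJm q hq) (h.1.source_subset q hq))).cast ?_ ?_ ?_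
      · change _ - c0 * ((-(c1 * _ / _) * _ + _) ^ 2 / 4 + _ * (c1 * _ / _) / 2) = 0
        rw [e1, e2, hc0 q hq]
        ring
      · change _ - c0 * (-(c1 * _ / _) * _ + _) / 2 = 0
        rw [e1, hc0 q hq]
        ring
      · rw [hc0 q hq]
        exact sub_self c0)
  refine ⟨c c4 c5 c6, fun q hq => R.den_ne _ (hJm q hq), fun q hq => ?_, fun q hq => ?_⟩
  · have e4 : P.xNew (c c4 c5 c6) E J q.1 q.2.1 = P.xNew (c 0 0 0) E J q.1 q.2.1 + c4 :=
      congrArg (· + c4) (add_zero _).symm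
    have e5 : P.tNew (c c4 c5 c6) E J q.1 = P.tNew (c 0 0 0) E J q.1 + c5 :=
      congrArg (· + c5) (add_zero _).symm
    have e6 : P.vNew (c c4 c5 c6) E J q.1 q.2.1 q.2.2
        = P.vNew (c 0 0 0) E J q.1 q.2.1 q.2.2 + c6 := congrArg (· + c6) (add_zero _).symm
    rw [e4, e5, e6, ← hc4 q hq, ← hc5 q hq, ← hc6 q hq]
    simp [tComp, xComp, vComp]
  · have e1 := (h.xComp_fiber hq).2.2.2
    have e2 := (F hq).2.1
    rw [hc0 q hq] at e2
    refine mul_right_cancel₀ (h.dt_tComp_ne_zero hq) ?_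
    change _ = c0 * _ * _
    linear_combination e1 - E.f (base q) * e2

end Necessity

/-! ### The stated form implies admissibility -/

section Sufficiency

variable {E E' E'' : PotBurgers} {φ ψ : LocalMap} {P : AntiderivativeChoice} {c : Constants}

theorem HasForm.regularInterval (hF : HasForm P c E φ E') (h : IsPointTransformation E φ E') :
    IsRegularInterval P c E (Prod.fst '' φ.source) :=
  h.regularInterval_of_den_ne hF.1

/-- Transformations of the stated form map solutions to solutions. -/
theorem HasForm.mapsEquation (hE : E ∈ quadClass) (h : IsPointTransformation E φ E')
    (hF : HasForm P c E φ E') : MapsEquation E φ E' := by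
  intro q hq v v' sv sv' hvq hvq' hgraph
  have R := hF.regularInterval h
  have hJ : ∀ r ∈ φ.source, r.1 ∈ Prod.fst '' φ.source := fun r hr => mem_image_of_mem _ hr
  have near : ∀ {q}, q ∈ φ.source → ∀ᶠ r in 𝓝 q, r ∈ φ.source := fun hq =>
    φ.open_source.mem_nhds hq
  set X1 := P.X1 c E with hX1
  set Y := P.Y c E with hY
  -- `-h'` is the slope of the drift `X_t / X_x`
  set h' : ℝ → ℝ := fun t => c.c1 * X1 t / P.lam E t with hh'
  have pT : ∀ r ∈ φ.source, HasPartials (tComp φ) (X1 r.1 ^ 2 / c.c0) 0 0 r := fun r hr =>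
    (HasPartials.of_time (R.hasDerivAt_tNew hE (hJ r hr))).congr
      ((near hr).mono fun z hz => congrArg Prod.fst (hF.2.1 z hz))
  have pX : ∀ r ∈ φ.source, HasPartials (xComp φ)
      (X1 r.1 * (-h' r.1 * r.2.1 + X1 r.1 * Y r.1)) (X1 r.1) 0 r := fun r hr =>
    (R.hasPartials_xNew hE (hJ r hr)).congr
      ((near hr).mono fun z hz => congrArg (fun z => z.2.1) (hF.2.1 z hz))
  have pV : ∀ r ∈ φ.source, HasPartials (vComp φ)
      (c.c0 * ((-h' r.1 * r.2.1 + X1 r.1 * Y r.1) ^ 2 / 4 + E.f (base r) * h' r.1 / 2))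
      (c.c0 * (-h' r.1 * r.2.1 + X1 r.1 * Y r.1) / 2) c.c0 r := fun r hr =>
    (R.hasPartials_vNew hE (hJ r hr) (h.source_subset r hr)).congr
      ((near hr).mono fun z hz => congrArg (fun z => z.2.2) (hF.2.1 z hz))
  have pVx : HasPartials (dx (vComp φ)) (dt (dx (vComp φ)) q) (-(c.c0 * h' q.1) / 2) 0 q := by
    have sV := h.smooth_vComp hq
    have hx : deriv (fun r : ℝ => c.c0 * (-h' q.1 * r + X1 q.1 * Y q.1) / 2) q.2.1
        = -(c.c0 * h' q.1) / 2 := by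
      have := ((((hasDerivAt_id q.2.1).const_mul (-h' q.1)).add_const
        (X1 q.1 * Y q.1)).const_mul c.c0).div_const 2
      exact this.deriv.trans (by ring)
    have hline : Tendsto (fun y : ℝ => (q.1, y, q.2.2)) (𝓝 q.2.1) (𝓝 q) :=
      (by fun_prop : Continuous fun y : ℝ => (q.1, y, q.2.2)).tendsto' _ _ rfl
    refine sV.smooth_dx.smooth_hasPartials.cast rfl ?_ ?_
    · rw [← hx, ← sV.smooth_dx.smooth_hasPartials.hasDerivAt_snd.deriv]
      exact EventuallyEq.deriv_eq ((hline.eventually (near hq)).mono fun y hy => (pV _ hy).dx_eq)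
    · rw [sV.dv_dx]
      exact (((HasPartials.const c.c0 q).congr
        ((near hq).mono fun r hr => (pV r hr).dv_eq))).dx_eq
  have dvV : HasPartials (dv (vComp φ)) 0 0 0 q :=
    (HasPartials.const c.c0 q).congr ((near hq).mono fun r hr => (pV r hr).dv_eq)
  have zTx := partials_eq_zero ((near hq).mono fun r hr => (pT r hr).dx_eq)
  have zTv := partials_eq_zero ((near hq).mono fun r hr => (pT r hr).dv_eq)
  have zXv := partials_eq_zero ((near hq).mono fun r hr => (pX r hr).dv_eq)
  have hXxx : dx (dx (xComp φ)) q = 0 := by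
    have hd := HasPartials.of_time (q := q)
      (P.hasDerivAt_X1 hE (R.subset_times (hJ q hq)) (hF.1 q hq))
    exact (hd.congr ((near hq).mono fun r hr => (pX r hr).dx_eq)).dx_eq
  obtain ⟨j1, j2, j3⟩ := jet_relations (w := fun r => v (base r)) (w' := fun r => v' (base r))
    (h.smooth_tComp hq) (h.smooth_xComp hq) (h.smooth_vComp hq) sv.comp_base
    (ContDiffAt.comp_base (q := (tComp φ q, xComp φ q, 0)) sv') hvq.symm
    ((tendsto_graph sv hvq).eventually hgraph |>.mono fun r hr => hr.1 rfl)
  rw [zTx.2.1, zTv.2.1, zTv.2.2, zXv.2.1, zXv.2.2, hXxx, pVx.dx_eq, dvV.dx_eq, dvV.dv_eq] at j3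
  rw [(pT q hq).dx_eq, (pT q hq).dv_eq, (pX q hq).dx_eq, (pX q hq).dv_eq, (pV q hq).dv_eq] at j3
  rw [(pT q hq).dx_eq, (pT q hq).dv_eq, (pX q hq).dx_eq, (pX q hq).dv_eq, (pV q hq).dv_eq,
    (pV q hq).dx_eq] at j2
  rw [(pT q hq).dt_eq, (pT q hq).dv_eq, (pX q hq).dt_eq, (pX q hq).dv_eq, (pV q hq).dv_eq,
    (pV q hq).dt_eq] at j1
  have hX1ne : X1 q.1 ≠ 0 := P.X1_ne (hF.1 q hq)
  have hc0 := c.c0_ne_zero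
  rw [satisfiesAt_iff sv, show base (φ q) = base (tComp φ q, xComp φ q, 0) from rfl,
    satisfiesAt_iff (q := (tComp φ q, xComp φ q, 0)) sv',
    show base (tComp φ q, xComp φ q, 0) = base (φ q) from rfl, hF.2.2 q hq]
  set α := dt (fun r => v' (base r)) (tComp φ q, xComp φ q, 0)
  set β := dx (fun r => v' (base r)) (tComp φ q, xComp φ q, 0)
  set γ := dx (dx (fun r => v' (base r))) (tComp φ q, xComp φ q, 0)
  set s := dt (fun r => v (base r)) q
  set p := dx (fun r => v (base r)) q
  set r := dx (dx (fun r => v (base r))) q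
  -- the left-hand sides of the two equations are proportional
  have key : X1 q.1 ^ 2 * (α + β ^ 2 + c.c0 * E.f (base q) * γ) =
      c.c0 ^ 2 * (s + p ^ 2 + E.f (base q) * r) := by
    have j1' := congrArg (fun z => c.c0 * z) j1
    simp only [zero_mul, add_zero] at j1'
    have e : c.c0 * (α * (X1 q.1 ^ 2 / c.c0)) = α * X1 q.1 ^ 2 := by field_simp
    linear_combination -e - j1' + c.c0 * (-h' q.1 * q.2.1 + X1 q.1 * Y q.1) * j2
      - c.c0 * E.f (base q) * j3 - (β * X1 q.1 + (c.c0 * (-h' q.1 * q.2.1 + X1 q.1 * Y q.1) / 2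
      + c.c0 * p)) * j2
  constructor
  · intro h0
    rw [h0, mul_zero] at key
    exact (mul_eq_zero.1 key).resolve_left (pow_ne_zero 2 hX1ne)
  · intro h0
    rw [h0, mul_zero] at key
    exact (mul_eq_zero.1 key.symm).resolve_left (pow_ne_zero 2 hc0)

theorem MapsEquation.symm (h : MapsEquation E φ E') : MapsEquation E' φ.symm E := by
  intro y hy v' v sv' sv hv' hv hg
  have hq : φ.symm y ∈ φ.source := φ.map_target hy
  have hy' : φ (φ.symm y) = y := φ.right_inv hy
  have := h (φ.symm y) hq v v' sv (by rwa [hy']) hv (by rwa [hy']) (by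
    have ht : Tendsto φ (𝓝 (φ.symm y)) (𝓝 y) := by
      have := (φ.continuousAt hq).tendsto
      rwa [hy'] at this
    filter_upwards [ht.eventually hg, φ.open_source.mem_nhds hq] with r hr hrs
    rw [φ.left_inv hrs] at hr
    exact hr.symm)
  rw [hy'] at this
  exact this.symm

theorem IsAdmissible.symm (h : IsAdmissible E φ E') : IsAdmissible E' φ.symm E :=
  ⟨h.1.symm, h.2.symm⟩

/-- An admissible transformation locally maps graphs to graphs. -/
theorem IsAdmissible.exists_image_graph (h : IsAdmissible E φ E') {q : ℝ × ℝ × ℝ}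
    (hq : q ∈ φ.source) {v : ℝ × ℝ → ℝ} (sv : ContDiffAt ℝ ∞ v (base q)) (hv : OnGraph v q) :
    ∃ v' : ℝ × ℝ → ℝ, ContDiffAt ℝ ∞ v' (base (φ q)) ∧ OnGraph v' (φ q) ∧
      ∀ᶠ s in 𝓝 (φ q), (OnGraph v' s ↔ OnGraph v (φ.symm s)) := by
  have hy : φ q ∈ φ.symm.source := φ.map_source hq
  have hqq : (tComp φ.symm (φ q), xComp φ.symm (φ q), vComp φ.symm (φ q)) = q := φ.left_inv hq
  have sT := h.symm.1.smooth_tComp hy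
  have sX := h.symm.1.smooth_xComp hy
  have sV := h.symm.1.smooth_vComp hy
  have sw : ContDiffAt ℝ ∞ (fun r => v (base r))
      (tComp φ.symm (φ q), xComp φ.symm (φ q), vComp φ.symm (φ q)) := by
    rw [hqq]
    exact sv.comp_base
  have hmap : ContDiffAt ℝ ∞ (fun s => (tComp φ.symm s, xComp φ.symm s, vComp φ.symm s)) (φ q) :=
    sT.prodMk (sX.prodMk sV)
  set F : ℝ × ℝ × ℝ → ℝ := fun s => vComp φ.symm s -
    v (base (tComp φ.symm s, xComp φ.symm s, vComp φ.symm s)) with hF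
  have sF : ContDiffAt ℝ ∞ F (φ q) :=
    sV.sub (ContDiffAt.comp (g := fun r => v (base r)) (φ q) sw hmap)
  have hzero : ∀ s, F s = 0 ↔ OnGraph v (φ.symm s) := fun s => sub_eq_zero
  have hF0 : F (φ q) = 0 := (hzero _).2 (by rwa [φ.left_inv hq])
  have hFv : dv F (φ q) ≠ 0 := by
    have := (sV.smooth_hasPartials.sub (HasPartials.comp sw.smooth_hasPartials
      sT.smooth_hasPartials sX.smooth_hasPartials sV.smooth_hasPartials)).dv_eq
    rw [(h.symm.tComp_time hy).2, (h.symm.xComp_fiber hy).1, dv_comp_base v (by rwa [hqq])] at this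
    rw [hF, this]
    simpa using (h.symm.xComp_fiber hy).2.2.1
  obtain ⟨v', sv', hv', hev⟩ := exists_onGraph_iff_eq_zero sF hF0 hFv
  exact ⟨v', sv', hv', hev.mono fun s hs => hs.trans (hzero s)⟩

/-- Admissible transformations are closed under composition and restriction. -/
theorem IsAdmissible.trans_restr (h : IsAdmissible E φ E') (k : IsAdmissible E' ψ E'')
    {W : Set (ℝ × ℝ × ℝ)} (hc : IsConnected ((φ.trans ψ).restr W).source) :
    IsAdmissible E ((φ.trans ψ).restr W) E'' := by
  set χ := (φ.trans ψ).restr W with hχ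
  have src : ∀ {q}, q ∈ χ.source → q ∈ φ.source ∧ φ q ∈ ψ.source := by
    intro q hq
    rw [hχ, OpenPartialHomeomorph.restr_source, OpenPartialHomeomorph.trans_source] at hq
    exact hq.1
  have tgt : ∀ {y}, y ∈ χ.target → y ∈ ψ.target ∧ ψ.symm y ∈ φ.target := by
    intro y hy
    have h1 := χ.map_target hy
    have h2 := χ.right_inv hy
    obtain ⟨h3, h4⟩ := src h1
    have h5 : ψ (φ (χ.symm y)) = y := h2
    have h6 : ψ.symm y = φ (χ.symm y) := by rw [← h5, ψ.left_inv h4, h5]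
    exact ⟨h5 ▸ ψ.map_source h4, h6 ▸ φ.map_source h3⟩
  refine ⟨⟨?_, ?_, hc, fun q hq => h.1.source_subset q (src hq).1,
    fun y hy => k.1.target_subset y (tgt hy).1⟩, ?_⟩
  · exact k.1.contDiffOn.comp (h.1.contDiffOn.mono fun q hq => (src hq).1) fun q hq => (src hq).2
  · exact h.1.contDiffOn_symm.comp (k.1.contDiffOn_symm.mono fun y hy => (tgt hy).1)
      fun y hy => (tgt hy).2
  · intro q hq v v'' sv sv'' hv hv'' hg
    obtain ⟨hq1, hq2⟩ := src hq
    obtain ⟨v', sv', hv', hev⟩ := h.exists_image_graph hq1 sv hv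
    have ht : Tendsto φ (𝓝 q) (𝓝 (φ q)) := φ.continuousAt hq1
    have ht' : Tendsto φ.symm (𝓝 (φ q)) (𝓝 q) := by
      have := (φ.symm.continuousAt (x := φ q) (φ.map_source hq1)).tendsto
      rwa [φ.left_inv hq1] at this
    refine (h.2 q hq1 v v' sv sv' hv hv' ?_).trans
      (k.2 (φ q) hq2 v' v'' sv' sv'' hv' hv'' ?_)
    · filter_upwards [ht.eventually hev, φ.open_source.mem_nhds hq1] with r hr hrs
      rw [φ.left_inv hrs] at hr
      exact hr.symm
    · filter_upwards [hev, ht'.eventually hg, φ.open_target.mem_nhds (φ.map_source hq1)]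
        with s hs hs' hst
      refine hs.trans (hs'.trans ?_)
      change OnGraph v'' (ψ (φ (φ.symm s))) ↔ _
      rw [φ.right_inv hst]

end Sufficiency

/-! ### Realization of the formulas -/

/-- The part of the domain of an equation over an interval of values of `t` is connected, since the
sections `t = const` are intervals. -/
theorem PotBurgers.isConnected_restrict (E : PotBurgers) {J : Set ℝ} (hJo : IsOpen J)
    (hJc : J.OrdConnected) (hJn : J.Nonempty) (hJ : J ⊆ E.times) :
    IsConnected {z | z ∈ E.dom ∧ z.1 ∈ J} := by
  refine ⟨?_, ?_⟩
  · obtain ⟨t, ht⟩ := hJn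
    obtain ⟨z, hz, rfl⟩ := hJ ht
    exact ⟨z, hz, ht⟩
  have hD : IsOpen {z | z ∈ E.dom ∧ z.1 ∈ J} := E.isOpen_dom.inter (hJo.preimage continuous_fst)
  intro U V hU hV hcov ⟨y, hyD, hyU⟩ ⟨z, hzD, hzV⟩
  obtain ⟨t, htJ, ⟨p, ⟨hpD, hpU⟩, hp⟩, ⟨r, ⟨hrD, hrV⟩, hr⟩⟩ := hJc.isPreconnected
    (Prod.fst '' ({z | z ∈ E.dom ∧ z.1 ∈ J} ∩ U)) (Prod.fst '' ({z | z ∈ E.dom ∧ z.1 ∈ J} ∩ V))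
    (isOpenMap_fst _ (hD.inter hU)) (isOpenMap_fst _ (hD.inter hV)) (by
      intro t ht
      obtain ⟨w, hw, rfl⟩ := hJ ht
      rcases hcov ⟨hw, ht⟩ with h | h
      · exact Or.inl ⟨w, ⟨⟨hw, ht⟩, h⟩, rfl⟩
      · exact Or.inr ⟨w, ⟨⟨hw, ht⟩, h⟩, rfl⟩)
    ⟨y.1, hyD.2, y, ⟨hyD, hyU⟩, rfl⟩ ⟨z.1, hzD.2, z, ⟨hzD, hzV⟩, rfl⟩
  obtain ⟨p1, p2⟩ := p
  obtain ⟨r1, r2⟩ := r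
  simp only at hp hr
  subst hp hr
  have hline : Continuous fun x : ℝ => (r1, x) := by fun_prop
  obtain ⟨x, hx, hxU, hxV⟩ := (E.ordConnected_slice r1).isPreconnected
    ((fun x : ℝ => (r1, x)) ⁻¹' U) ((fun x : ℝ => (r1, x)) ⁻¹' V) (hU.preimage hline)
    (hV.preimage hline) (fun x hx => hcov ⟨hx, htJ⟩) ⟨p2, hpD.1, hpU⟩ ⟨r2, hrD.1, hrV⟩
  exact ⟨(r1, x), ⟨hx, htJ⟩, hxU, hxV⟩

/-- A smooth function on an open interval whose derivative has the sign of `k` everywhere is a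
diffeomorphism onto its image. -/
theorem exists_diffeo_of_deriv {T T' : ℝ → ℝ} {J : Set ℝ} {k : ℝ} (hJo : IsOpen J)
    (hJc : J.OrdConnected) (hT : ContDiffOn ℝ ∞ T J) (hd : ∀ t ∈ J, HasDerivAt T (T' t) t)
    (hk : ∀ t ∈ J, 0 < k * T' t) :
    ∃ e : OpenPartialHomeomorph ℝ ℝ, e.source = J ∧ (∀ t, e t = T t) ∧
      ContDiffOn ℝ ∞ e.symm e.target := by
  have hne : ∀ t ∈ J, T' t ≠ 0 := fun t ht h0 => by
    have := hk t ht
    rw [h0, mul_zero] at this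
    exact lt_irrefl _ this
  have hinj : InjOn T J := by
    have hmono : StrictMonoOn (fun t => k * T t) J := by
      refine strictMonoOn_of_deriv_pos hJc.convex (continuousOn_const.mul hT.continuousOn)
        fun t ht => ?_
      have ht' := interior_subset ht
      rw [((hd t ht').const_mul k).deriv]
      exact hk t ht'
    intro a ha b hb hab
    exact hmono.injOn ha hb (by simp only [hab])
  have hstrict : ∀ t ∈ J, HasStrictDerivAt T (T' t) t := fun t ht =>
    (hT.contDiffAt (hJo.mem_nhds ht)).hasStrictDerivAt' (hd t ht) (by simp)
  have hopen : IsOpenMap (J.domRestrict T) := by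
    refine isOpenMap_iff_nhds_le.2 fun t => ?_
    have h1 : map (J.domRestrict T) (𝓝 t) = map T (map Subtype.val (𝓝 t)) := by
      rw [Filter.map_map]; rfl
    rw [h1, map_nhds_subtype_coe_eq_nhds t.2 (hJo.mem_nhds t.2),
      (hstrict t t.2).map_nhds_eq (hne t t.2)]
    rfl
  let e := OpenPartialHomeomorph.ofContinuousOpenRestrict (hinj.toPartialEquiv T J)
    hT.continuousOn hopen hJo
  refine ⟨e, rfl, fun t => rfl, fun y hy => ?_⟩
  have ht : e.symm y ∈ J := e.map_target hy
  exact (e.contDiffAt_symm_deriv (hne _ ht) hy (hd _ ht)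
    (hT.contDiffAt (hJo.mem_nhds ht))).contDiffWithinAt

namespace IsRegularInterval

variable {P : AntiderivativeChoice} {c : Constants} {E : PotBurgers} {J : Set ℝ}

theorem smooth_tNew (R : IsRegularInterval P c E J) (hE : E ∈ quadClass) :
    ContDiffOn ℝ ∞ (P.tNew c E J) J :=
  (contDiffOn_const.mul (P.smooth_int R.isOpen R.ordConnected (R.smooth_X1_sq hE))).add
    contDiffOn_const

theorem smooth_xNew (R : IsRegularInterval P c E J) (hE : E ∈ quadClass) {A : Type*}
    [NormedAddCommGroup A] [NormedSpace ℝ A] {S : Set A} {a b : A → ℝ}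
    (ha : ContDiffOn ℝ ∞ a S) (hb : ContDiffOn ℝ ∞ b S) (hS : MapsTo a S J) :
    ContDiffOn ℝ ∞ (fun z => P.xNew c E J (a z) (b z)) S :=
  ((((R.smooth_X1 hE).comp ha hS).mul hb).add ((P.smooth_int R.isOpen R.ordConnected
    (R.smooth_X1_sq_mul_Y hE)).comp ha hS)).add contDiffOn_const

theorem smooth_vNew (R : IsRegularInterval P c E J) (hE : E ∈ quadClass) {A : Type*}
    [NormedAddCommGroup A] [NormedSpace ℝ A] {S : Set A} {a b d : A → ℝ}
    (ha : ContDiffOn ℝ ∞ a S) (hb : ContDiffOn ℝ ∞ b S) (hd : ContDiffOn ℝ ∞ d S)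
    (hS : MapsTo a S J) :
    ContDiffOn ℝ ∞ (fun z => P.vNew c E J (a z) (b z) (d z)) S := by
  have h1 := (R.smooth_X1 hE).comp ha hS
  have h2 := (R.smooth_X2 hE).comp ha hS
  have h3 := (P.smooth_lam hE).comp ha (hS.mono_right R.subset_times)
  have h4 := (P.smooth_int R.isOpen R.ordConnected (R.smooth_X2_sq hE)).comp ha hS
  have h5 := (P.smooth_int R.isOpen R.ordConnected (R.smooth_f0_term hE)).comp ha hS
  exact (contDiffOn_const.mul ((((hd.sub (((contDiffOn_const.mul h1).div
    (contDiffOn_const.mul h3) fun z _ => mul_ne_zero four_ne_zero (P.lam_ne _)).mul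
    (hb.pow 2))).add (h2.mul hb)).add h4).add (contDiffOn_const.mul h5))).add contDiffOn_const

/-- Over a nonempty regular interval, the formulas define a point transformation onto an equation
of the subclass. -/
theorem exists_transformation (R : IsRegularInterval P c E J) (hE : E ∈ quadClass)
    (hJn : J.Nonempty) :
    ∃ (φ : LocalMap) (E' : PotBurgers), E' ∈ quadClass ∧ IsPointTransformation E φ E' ∧
      HasForm P c E φ E' ∧ φ.source = {q | base q ∈ E.dom ∧ q.1 ∈ J} ∧
      φ.target = {q | base q ∈ E'.dom} := by
  have hc0 := c.c0_ne_zero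
  obtain ⟨e, heJ, heT, hes⟩ := exists_diffeo_of_deriv (k := c.c0) R.isOpen R.ordConnected
    (R.smooth_tNew hE) (fun t ht => R.hasDerivAt_tNew hE ht) (fun t ht => by
      have := sq_pos_of_ne_zero (P.X1_ne (R.den_ne t ht))
      rw [mul_div_cancel₀ _ hc0]
      exact this)
  have hmapJ : ∀ {y}, y ∈ e.target → e.symm y ∈ J := fun hy => heJ ▸ e.map_target hy
  have hX1 : ∀ {t}, t ∈ J → P.X1 c E t ≠ 0 := fun ht => P.X1_ne (R.den_ne _ ht)
  -- the induced map of the `(t,x)`-plane and its inverse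
  set α : ℝ × ℝ → ℝ × ℝ := fun z => (e z.1, P.xNew c E J z.1 z.2) with hα
  set β : ℝ × ℝ → ℝ × ℝ := fun z =>
    (e.symm z.1, (z.2 - P.xNew c E J (e.symm z.1) 0) / P.X1 c E (e.symm z.1)) with hβ
  have hx_aff : ∀ t x, P.xNew c E J t x = P.X1 c E t * x + P.xNew c E J t 0 := by
    intro t x
    simp only [AntiderivativeChoice.xNew]
    ring
  have hv_aff : ∀ t x v, P.vNew c E J t x v = c.c0 * v + P.vNew c E J t x 0 := by
    intro t x v
    simp only [AntiderivativeChoice.vNew]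
    ring
  have hβα : ∀ z : ℝ × ℝ, z.1 ∈ J → β (α z) = z := by
    intro z hz
    have h1 : e.symm (e z.1) = z.1 := e.left_inv (heJ ▸ hz)
    have h2 := hX1 hz
    simp only [hα, hβ, h1]
    refine Prod.ext rfl ?_
    simp only
    rw [hx_aff z.1 z.2]
    field_simp
    ring
  have hαβ : ∀ z : ℝ × ℝ, z.1 ∈ e.target → α (β z) = z := by
    intro z hz
    have h2 := hX1 (hmapJ hz)
    refine Prod.ext (e.right_inv hz) ?_
    simp only [hα, hβ]
    rw [hx_aff]
    field_simp
    ring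
  have sα : ContDiffOn ℝ ∞ α {z | z.1 ∈ J} := by
    have h1 : ContDiffOn ℝ ∞ (fun z : ℝ × ℝ => e z.1) {z | z.1 ∈ J} :=
      ((R.smooth_tNew hE).congr fun t _ => heT t).comp contDiffOn_fst fun z hz => hz
    exact h1.prodMk (R.smooth_xNew hE contDiffOn_fst contDiffOn_snd fun z hz => hz)
  have sβ : ContDiffOn ℝ ∞ β {z | z.1 ∈ e.target} := by
    have h1 : ContDiffOn ℝ ∞ (fun z : ℝ × ℝ => e.symm z.1) {z | z.1 ∈ e.target} :=
      hes.comp contDiffOn_fst fun z hz => hz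
    exact h1.prodMk ((contDiffOn_snd.sub (R.smooth_xNew hE h1 contDiffOn_const
      fun z hz => hmapJ hz)).div ((R.smooth_X1 hE).comp h1 fun z hz => hmapJ hz)
      fun z hz => hX1 (hmapJ hz))
  have oJ : IsOpen {z : ℝ × ℝ | z.1 ∈ J} := R.isOpen.preimage continuous_fst
  have oT : IsOpen {z : ℝ × ℝ | z.1 ∈ e.target} := e.open_target.preimage continuous_fst
  set dom' : Set (ℝ × ℝ) := {z | z.1 ∈ e.target} ∩ β ⁻¹' E.dom with hdom'
  have odom' : IsOpen dom' := sβ.continuousOn.isOpen_inter_preimage oT E.isOpen_dom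
  have himage : dom' = α '' {z | z ∈ E.dom ∧ z.1 ∈ J} := by
    ext z
    constructor
    · rintro ⟨hz1, hz2⟩
      exact ⟨β z, ⟨hz2, hmapJ hz1⟩, hαβ z hz1⟩
    · rintro ⟨w, ⟨hw1, hw2⟩, rfl⟩
      refine ⟨e.map_source (heJ ▸ hw2), ?_⟩
      change β (α w) ∈ E.dom
      rwa [hβα w hw2]
  let E' : PotBurgers :=
    { dom := dom'
      f := fun z => c.c0 * E.f (β z)
      isOpen_dom := odom'
      isConnected_dom := by
        rw [himage]
        exact (E.isConnected_restrict R.isOpen R.ordConnected hJn R.subset_times).image _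
          (sα.continuousOn.mono fun z hz => hz.2)
      ordConnected_slice := by
        intro t
        by_cases ht : t ∈ e.target
        · have : {x | (t, x) ∈ dom'} = (fun x => (x - P.xNew c E J (e.symm t) 0) /
              P.X1 c E (e.symm t)) ⁻¹' {x | (e.symm t, x) ∈ E.dom} := by
            ext x
            exact ⟨fun h => h.2, fun h => ⟨ht, h⟩⟩
          rw [this]
          rcases le_total 0 (P.X1 c E (e.symm t)) with h | h
          · exact (E.ordConnected_slice _).preimage_mono fun x y hxy =>
              div_le_div_of_nonneg_right (by linarith) h
          · exact (E.ordConnected_slice _).preimage_anti fun x y hxy =>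
              div_le_div_of_nonpos_of_le h (by linarith)
        · have : {x | (t, x) ∈ dom'} = ∅ := by
            ext x
            exact ⟨fun h => (ht h.1).elim, fun h => h.elim⟩
          rw [this]
          exact ordConnected_empty
      contDiffOn_f := contDiffOn_const.mul
        (E.contDiffOn_f.comp (sβ.mono fun z hz => hz.1) fun z hz => hz.2)
      f_ne_zero := fun z hz => mul_ne_zero hc0 (E.f_ne_zero _ hz.2) }
  have hE' : E' ∈ quadClass := by
    refine ⟨fun z hz => ?_, fun W hW hWn hWd ⟨k, hk⟩ => ?_⟩
    · obtain ⟨t, x⟩ := z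
      have hX := hX1 (hmapJ hz.1)
      set s := e.symm t with hs
      set a := P.X1 c E s with ha
      set b := P.xNew c E J s 0 with hb
      have near : (fun y => E'.f (t, y)) =ᶠ[𝓝 x] fun y => c.c0 * E.f2 s / a ^ 2 * y ^ 2
          + c.c0 * (E.f1 s / a - 2 * E.f2 s * b / a ^ 2) * y
          + c.c0 * (E.f2 s * b ^ 2 / a ^ 2 - E.f1 s * b / a + E.f0 s) := by
        filter_upwards [(E'.isOpen_slice t).mem_nhds hz] with y hy
        have hy' : (s, (y - b) / a) ∈ E.dom := hy.2
        change c.c0 * E.f (s, (y - b) / a) = _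
        rw [E.f_eq hE hy']
        simp only
        field_simp
        ring
      simp only
      rw [near.iteratedDeriv_eq, iteratedDeriv_three_quadratic]
    · have hopen : IsOpen ({z | z.1 ∈ J} ∩ α ⁻¹' W) :=
        sα.continuousOn.isOpen_inter_preimage oJ hW
      refine hE.2 _ hopen ?_ ?_ ⟨k / c.c0, ?_⟩
      · obtain ⟨w, hw⟩ := hWn
        have hwd := hWd hw
        refine ⟨β w, hmapJ hwd.1, ?_⟩
        change α (β w) ∈ W
        rwa [hαβ w hwd.1]
      · rintro z ⟨hz, hzW⟩
        have : β (α z) ∈ E.dom := (hWd hzW).2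
        rwa [hβα z hz] at this
      · rintro z ⟨hz, hzW⟩
        have : c.c0 * E.f (β (α z)) = k := hk _ hzW
        rw [hβα z hz] at this
        rw [← this]
        field_simp
  have sinv : ContDiffOn ℝ ∞ (fun y : ℝ × ℝ × ℝ => β (base y)) {y | y.1 ∈ e.target} :=
    sβ.comp contDiff_base.contDiffOn fun y hy => hy
  have sfwd : ContDiffOn ℝ ∞ (fun q : ℝ × ℝ × ℝ =>
      (e q.1, P.xNew c E J q.1 q.2.1, P.vNew c E J q.1 q.2.1 q.2.2)) {q | q.1 ∈ J} := by
    have h0 : ContDiffOn ℝ ∞ (fun q : ℝ × ℝ × ℝ => q.2.1) {q | q.1 ∈ J} :=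
      (contDiff_fst.comp contDiff_snd).contDiffOn
    have h1 : ContDiffOn ℝ ∞ (fun q : ℝ × ℝ × ℝ => q.2.2) {q | q.1 ∈ J} :=
      (contDiff_snd.comp contDiff_snd).contDiffOn
    have h2 : ContDiffOn ℝ ∞ (fun q : ℝ × ℝ × ℝ => e q.1) {q | q.1 ∈ J} :=
      ((R.smooth_tNew hE).congr fun t _ => heT t).comp contDiffOn_fst fun q hq => hq
    exact h2.prodMk ((R.smooth_xNew hE contDiffOn_fst h0 fun q hq => hq).prodMk
      (R.smooth_vNew hE contDiffOn_fst h0 h1 fun q hq => hq))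
  have sbwd : ContDiffOn ℝ ∞ (fun y : ℝ × ℝ × ℝ => ((β (base y)).1, (β (base y)).2,
      (y.2.2 - P.vNew c E J (β (base y)).1 (β (base y)).2 0) / c.c0)) {y | y.1 ∈ e.target} := by
    have h1 : ContDiffOn ℝ ∞ (fun q : ℝ × ℝ × ℝ => q.2.2) {y | y.1 ∈ e.target} :=
      (contDiff_snd.comp contDiff_snd).contDiffOn
    have b1 := contDiff_fst.comp_contDiffOn sinv
    have b2 := contDiff_snd.comp_contDiffOn sinv
    exact b1.prodMk (b2.prodMk ((h1.sub (R.smooth_vNew hE b1 b2 contDiffOn_const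
      fun y hy => hmapJ hy)).div_const _))
  let φ : LocalMap :=
    { toFun := fun q => (e q.1, P.xNew c E J q.1 q.2.1, P.vNew c E J q.1 q.2.1 q.2.2)
      invFun := fun y => ((β (base y)).1, (β (base y)).2,
        (y.2.2 - P.vNew c E J (β (base y)).1 (β (base y)).2 0) / c.c0)
      source := {q | base q ∈ E.dom ∧ q.1 ∈ J}
      target := {y | base y ∈ dom'}
      map_source' := fun q hq => by
        change α (base q) ∈ dom'
        rw [himage]
        exact mem_image_of_mem _ hq
      map_target' := fun y hy => ⟨hy.2, hmapJ hy.1⟩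
      left_inv' := fun q hq => by
        have h1 : β (α (base q)) = base q := hβα _ hq.2
        have h2 : base (e q.1, P.xNew c E J q.1 q.2.1, P.vNew c E J q.1 q.2.1 q.2.2)
          = α (base q) := rfl
        rw [h2, h1]
        refine Prod.ext rfl (Prod.ext rfl ?_)
        simp only [base]
        rw [hv_aff q.1 q.2.1 q.2.2]
        field_simp
        ring
      right_inv' := fun y hy => by
        have h1 : α (β (base y)) = base y := hαβ _ hy.1
        have h2 : e (β (base y)).1 = y.1 := congrArg Prod.fst h1
        have h3 : P.xNew c E J (β (base y)).1 (β (base y)).2 = y.2.1 := congrArg Prod.snd h1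
        refine Prod.ext h2 (Prod.ext h3 ?_)
        simp only
        rw [hv_aff]
        field_simp
        ring
      open_source := (E.isOpen_dom.preimage continuous_base).inter
        (R.isOpen.preimage continuous_fst)
      open_target := odom'.preimage continuous_base
      continuousOn_toFun := sfwd.continuousOn.mono fun q hq => hq.2
      continuousOn_invFun := sbwd.continuousOn.mono fun y hy => hy.1 }
  have hsrc : Prod.fst '' φ.source = J := by
    ext t
    constructor
    · rintro ⟨q, hq, rfl⟩
      exact hq.2
    · intro ht
      obtain ⟨z, hz, rfl⟩ := R.subset_times ht
      exact ⟨(z.1, z.2, 0), ⟨hz, ht⟩, rfl⟩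
  refine ⟨φ, E', hE', ⟨sfwd.mono fun q hq => hq.2, sbwd.mono fun y hy => hy.1, ?_,
    fun q hq => hq.1, fun y hy => hy⟩, ⟨fun q hq => R.den_ne _ hq.2, fun q hq => ?_,
    fun q hq => ?_⟩, rfl, rfl⟩
  · have h1 := (E.isConnected_restrict R.isOpen R.ordConnected hJn R.subset_times).prod
      (isConnected_univ (α := ℝ))
    have h2 : φ.source = (fun z : (ℝ × ℝ) × ℝ => (z.1.1, z.1.2, z.2)) ''
        ({z | z ∈ E.dom ∧ z.1 ∈ J} ×ˢ univ) := by
      ext q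
      constructor
      · intro hq
        exact ⟨(base q, q.2.2), ⟨hq, mem_univ _⟩, rfl⟩
      · rintro ⟨z, ⟨hz, -⟩, rfl⟩
        exact hz
    rw [h2]
    exact h1.image _ (by fun_prop)
  · rw [hsrc, ← heT]
    rfl
  · have h1 : β (α (base q)) = base q := hβα _ hq.2
    change c.c0 * E.f (β (α (base q))) = _
    rw [h1]

end IsRegularInterval

theorem AntiderivativeChoice.exists_regularInterval (P : AntiderivativeChoice) (c : Constants)
    {E : PotBurgers} (hE : E ∈ quadClass) :
    ∃ J, IsRegularInterval P c E J ∧ J.Nonempty := by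
  have hne : ∃ t ∈ E.times, P.den c E t ≠ 0 := by
    by_contra hcon
    push Not at hcon
    obtain ⟨z, hz⟩ := E.isConnected_dom.nonempty
    have ht := PotBurgers.mem_times hz
    -- the derivative `c₁ / λ` of the vanishing denominator vanishes as well
    have h1 : c.c1 / P.lam E z.1 = 0 := by
      have e : P.den c E =ᶠ[𝓝 z.1] fun _ => 0 :=
        Filter.mem_of_superset (E.isOpen_times.mem_nhds ht) hcon
      rw [← (P.hasDerivAt_den hE ht).deriv, e.deriv_eq, deriv_const]
    have hc1 : c.c1 = 0 := (div_eq_zero_iff.1 h1).resolve_right (P.lam_ne _)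
    have h2 := hcon _ ht
    simp only [den, hc1, zero_mul, zero_add] at h2
    exact c.c1_c2_ne_zero (by rw [hc1, h2])
  obtain ⟨t, ht, h0⟩ := hne
  have hmem : ∀ᶠ s in 𝓝 t, s ∈ E.times := E.isOpen_times.mem_nhds ht
  have hnear := hmem.and ((P.hasDerivAt_den (c := c) hE ht).continuousAt.eventually_ne h0)
  obtain ⟨ε, hε, hball⟩ := Metric.eventually_nhds_iff_ball.1 hnear
  exact ⟨Metric.ball t ε, ⟨Metric.isOpen_ball, (convex_ball t ε).ordConnected,
    fun s hs => (hball s hs).1, fun s hs => (hball s hs).2⟩, ⟨t, Metric.mem_ball_self hε⟩⟩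

/-! ### The generalized extended equivalence group -/

section Group

variable {P : AntiderivativeChoice} {c : Constants}

theorem HasForm.isAdmissible {E E' : PotBurgers} {φ : LocalMap} (hE : E ∈ quadClass)
    (h : IsPointTransformation E φ E') (hF : HasForm P c E φ E') : IsAdmissible E φ E' :=
  ⟨h, hF.mapsEquation hE h⟩

theorem formFamilies_subset (P : AntiderivativeChoice) :
    formFamilies P ⊆ genExtEquivGroup quadClass := by
  rintro Φ ⟨c, hc⟩ E
  exact (hc E).2.isAdmissible E.2 (hc E).1

/-- The formulas define an element of the group over any choice of intervals. -/
theorem IsRegularChoice.exists_family {J : quadClass → Set ℝ} (hJ : IsRegularChoice P c J) :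
    ∃ Φ : Family quadClass, ∀ E : quadClass,
      IsPointTransformation E (Φ.map E) (Φ.tgt E) ∧ HasForm P c E (Φ.map E) (Φ.tgt E) ∧
      (Φ.map E).source = {q | base q ∈ E.1.dom ∧ q.1 ∈ J E} ∧
      (Φ.map E).target = {q | base q ∈ (Φ.tgt E).1.dom} := by
  have key : ∀ E : quadClass, ∃ (φ : LocalMap) (E' : quadClass), IsPointTransformation E φ E' ∧
      HasForm P c E φ E' ∧ φ.source = {q | base q ∈ E.1.dom ∧ q.1 ∈ J E} ∧
      φ.target = {q | base q ∈ E'.1.dom} := by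
    intro E
    obtain ⟨h1, h2, h3, h4, h5⟩ := hJ E
    obtain ⟨φ, E', hE', h⟩ :=
      (IsRegularInterval.mk h1 h2 h4 h5).exists_transformation E.2 h3
    exact ⟨φ, ⟨E', hE'⟩, h⟩
  choose φ E' h using key
  exact ⟨⟨φ, E'⟩, h⟩

theorem exists_isRegularChoice (P : AntiderivativeChoice) (c : Constants) :
    ∃ J, IsRegularChoice P c J := by
  choose J hJ using fun E : quadClass => P.exists_regularInterval c E.2
  exact ⟨J, fun E => ⟨(hJ E).1.isOpen, (hJ E).1.ordConnected, (hJ E).2, (hJ E).1.subset_times,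
    (hJ E).1.den_ne⟩⟩

/-- An admissible transformation of one equation extends to a family given by the same constants on
all equations. -/
theorem IsAdmissible.exists_formFamily (P : AntiderivativeChoice) {E E' : quadClass}
    {φ : LocalMap} (h : IsAdmissible E φ E') :
    ∃ Φ ∈ formFamilies P, Φ.map E = φ ∧ Φ.tgt E = E' := by
  classical
  obtain ⟨c, hc⟩ := h.exists_hasForm P E.2
  obtain ⟨J, hJ⟩ := exists_isRegularChoice P c
  obtain ⟨Φ, hΦ⟩ := hJ.exists_family
  refine ⟨⟨Function.update Φ.map E φ, Function.update Φ.tgt E E'⟩, ⟨c, fun E₁ => ?_⟩,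
    Function.update_self .., Function.update_self ..⟩
  by_cases h₁ : E₁ = E
  · subst h₁
    simp only [Function.update_self]
    exact ⟨h.1, hc⟩
  · simp only [Function.update_of_ne h₁]
    exact ⟨(hΦ E₁).1, (hΦ E₁).2.1⟩

end Group

theorem proposition4 (P : AntiderivativeChoice) :
    -- the coefficients of the quadratic polynomial `f`
    (∀ E ∈ quadClass, ∀ p ∈ E.dom,
      E.f p = E.f2 p.1 * p.2 ^ 2 + E.f1 p.1 * p.2 + E.f0 p.1) ∧
    -- a family of point transformations belongs to the generalized extended equivalence group
    -- if and only if on every equation it is given by the formulas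
    (∀ Φ : Family quadClass, Φ ∈ genExtEquivGroup quadClass ↔
      ∀ E : quadClass, IsPointTransformation E (Φ.map E) (Φ.tgt E) ∧
        ∃ c : Constants, HasForm P c E (Φ.map E) (Φ.tgt E)) ∧
    -- for all values of the constants, the formulas define an element of that group; it is defined
    -- over any intervals of values of `t` where `X¹` is, and such intervals exist
    (∀ c : Constants, (∃ J, IsRegularChoice P c J) ∧
      ∀ J, IsRegularChoice P c J → ∃ Φ ∈ genExtEquivGroup quadClass, ∀ E : quadClass,
        HasForm P c E (Φ.map E) (Φ.tgt E) ∧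
        (Φ.map E).source = {q | base q ∈ E.1.dom ∧ q.1 ∈ J E} ∧
        (Φ.map E).target = {q | base q ∈ (Φ.tgt E).1.dom}) ∧
    -- the transformations given by the formulas are closed under composition and inversion
    IsLocalGroup (formFamilies P) ∧
    -- the subclass is normalized: every admissible transformation in it is induced by an element of
    -- the group, even by one with constants that do not depend on the equation
    IsNormalizedBy quadClass (genExtEquivGroup quadClass ∩ formFamilies P) := by
  refine ⟨fun E hE p hp => E.f_eq hE hp, fun Φ => ⟨fun h E => ⟨(h E).1,
    (h E).exists_hasForm P E.2⟩, fun h E => ?_⟩, fun c => ⟨exists_isRegularChoice P c,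
    fun J hJ => ?_⟩, ⟨fun Φ hΦ E => ?_, fun Φ hΦ Ψ hΨ E W _ hW => ?_⟩, fun E φ E' h => ?_⟩
  · obtain ⟨h1, c, h2⟩ := h E
    exact h2.isAdmissible E.2 h1
  · obtain ⟨Φ, hΦ⟩ := hJ.exists_family
    exact ⟨Φ, fun E => (hΦ E).2.1.isAdmissible E.2 (hΦ E).1, fun E => (hΦ E).2⟩
  · exact (formFamilies_subset P hΦ E).symm.exists_formFamily P
  · exact ((formFamilies_subset P hΦ E).trans_restr
      (formFamilies_subset P hΨ (Φ.tgt E)) hW).exists_formFamily P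
  · obtain ⟨Φ, hΦ, h1, h2⟩ := h.exists_formFamily P
    exact ⟨Φ, ⟨formFamilies_subset P hΦ, hΦ⟩, h1, h2⟩
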